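/- Let $n\ge 1$ and $t\ge 1$ be integers and let $S=\{1,\dots,n\}$. For a probability distribution $p=(p_1,\dots,p_n)$ on $S$, let $X_1,\dots,X_t$ be independent samples from $p$, let $U_t=p\bigl(S\setminus\{X_1,\dots,X_t\}\bigr)$ be the missing mass, and regard $\mathbb E U_t$ as a function of $p$ on the simplex of all probability distributions on $S$. (i) For every local maximizer $p$ of $\mathbb E U_t$ there is $h\in S$ such that the masses $p_i$, $i\ne h$, are all equal, and $p_i\le p_h$ for all $i$. There is a function $\tau:\mathbb N\to\mathbb N$ such that (ii) and (iii) hold: (ii) For every $n\ge1$ one has $\tau(n)>n$, and (a) for $1\le t<\tau(n)$ the uniform distribution $p_1=\dots=p_n=\frac1n$ is the unique global maximizer of $\mathbb E U_t$; (b) for $t>\tau(n)$ the global maximizer of $\mathbb E U_t$ is unique up to a permutation of the points of $S$, and there is $h\in S$ such that the masses $p_i$, $i\neq h$, are all equal and $p_i<p_h$ for all $i\ne h$ (for $n=1$ this last condition is void). (iii) $\tau(n)=n+\sqrt{2n}\,(1+o(1))$ as $n\to\infty$. (iv) If $n\ge 1$ and $t\ge n+\sqrt{2n}$, $p$ is a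 global maximizer of $\mathbb E U_t$, and $h$ is an atom of largest mass of $p$, then for every $i\ne h$ $$\frac1{t+1}<p_i<\frac1{t+1}+e^{-\sqrt{n/2}}.$$ -/

import Mathlib

open MeasureTheory

/-- The missing mass `P (S \ {X₁, …, X_t})` of a sample `X = (X₁, …, X_t)` from `S`. -/
noncomputable def missingMass {S : Type*} [MeasurableSpace S] (P : Measure S) {t : ℕ}
    (X : Fin t → S) : ℝ :=
  P.real (Set.range X)ᶜ

/-- The expected missing mass `𝔼 U_t`, when `X₁, …, X_t` are drawn independently from `P`. -/
noncomputable def expectedMissingMass {S : Type*} [MeasurableSpace S] (P : Measure S) (t : ℕ) : ℝ :=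
  ∫ X : Fin t → S, missingMass P X ∂(Measure.pi fun _ : Fin t => P)

/-- The measure on the `n`-point space with atoms `p i`, for a vector `p` of masses. -/
noncomputable def atomicMeasure {n : ℕ} (p : Fin n → ℝ) : Measure (Fin n) :=
  ∑ i, ENNReal.ofReal (p i) • Measure.dirac i

/-- `𝔼 U_t` as a function of the vector of masses. -/
noncomputable def EU {n : ℕ} (t : ℕ) (p : Fin n → ℝ) : ℝ :=
  expectedMissingMass (atomicMeasure p) t

/-- `p` is a distribution on `n` points and a local maximum of `𝔼 U_t` among all of them. -/
def IsLocalMaximizer {n : ℕ} (t : ℕ) (p : Fin n → ℝ) : Prop :=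
  p ∈ stdSimplex ℝ (Fin n) ∧ IsLocalMaxOn (EU t) (stdSimplex ℝ (Fin n)) p

/-- `p` is a distribution on `n` points and a global maximum of `𝔼 U_t` among all of them. -/
def IsGlobalMaximizer {n : ℕ} (t : ℕ) (p : Fin n → ℝ) : Prop :=
  p ∈ stdSimplex ℝ (Fin n) ∧ IsMaxOn (EU t) (stdSimplex ℝ (Fin n)) p

/-- All atoms other than `h` carry the same mass, which is at most the mass of `h`. -/
def IsHeavyAtom {n : ℕ} (p : Fin n → ℝ) (h : Fin n) : Prop :=
  (∀ i j, i ≠ h → j ≠ h → p i = p j) ∧ ∀ i, p i ≤ p h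

/-- All atoms other than `h` carry the same mass, which is less than the mass of `h`. -/
def IsStrictlyHeavyAtom {n : ℕ} (p : Fin n → ℝ) (h : Fin n) : Prop :=
  (∀ i j, i ≠ h → j ≠ h → p i = p j) ∧ ∀ i, i ≠ h → p i < p h

/-! By linearity `𝔼 U_t` is the sum of `f (p i)` with `f x = x (1 - x) ^ t`, and `f` is strictly
concave up to `2 / (t + 1)` and strictly convex beyond. Moving mass between two atoms then shows
that a local maximizer has at most one atom in the convex range and equal atoms elsewhere. With `n =
m + 1`, only the light mass `x ≤ 1 / n` remains free.

In the variable `r = m x / (1 - x)` the derivative of the one-parameter function has the sign of the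
polynomial `massSlope`, which vanishes at `1` and at most twice in `(0, 1)`. Two non-uniform
maximizers would force a third zero by Rolle, hence uniqueness.

Divided by the uniform value, the function is a mean of `a ^ t` and `b ^ t` with `b < 1 < a` fixed
for each non-uniform `x`; once at least `1`, it grows strictly with `t`. So uniform optimality holds
exactly up to a threshold. Sample size `n + 1` lies within it (`massSlope_nonneg`). Testing `x = 1 /
(t + 1)`, the maximum point of `f`, shows that `n + √(2n)` lies beyond it. For `t` near `n + a
√(2n)` with `a < 1`, the possible relative gain is about `(a² - 1) / n`, hence negative
(`isMaxOn_heavyMass_uniform_of_exp_le`).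

For the light mass, criticality reads `x - 1/(t+1) = r ^ (t-1) * (1 - m x - 1/(t+1))`, and `r` is
bounded by exhibiting a point where `massSlope` is negative. -/

/-- The contribution `x (1 - x) ^ t` of an atom of mass `x` to the expected missing mass. -/
def atomTerm (t : ℕ) (x : ℝ) : ℝ := x * (1 - x) ^ t

/-! ### Expected missing mass as a sum over atoms -/

theorem atomicMeasure_apply_singleton {n : ℕ} {p : Fin n → ℝ} (i : Fin n) :
    atomicMeasure p {i} = ENNReal.ofReal (p i) := by
  simp [atomicMeasure, Set.indicator_apply, Finset.sum_ite_eq']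

theorem isProbabilityMeasure_atomicMeasure {n : ℕ} {p : Fin n → ℝ}
    (hp : p ∈ stdSimplex ℝ (Fin n)) : IsProbabilityMeasure (atomicMeasure p) := by
  constructor
  simp only [atomicMeasure, Measure.coe_finsetSum, Finset.sum_apply, Measure.smul_apply,
    measure_univ, smul_eq_mul, mul_one]
  rw [← ENNReal.ofReal_sum_of_nonneg fun i _ => hp.1 i, hp.2, ENNReal.ofReal_one]

/-- Linearity of expectation: the samples avoiding `i` form a box, of product measure `(1 - p i) ^
t`. -/
theorem EU_eq_sum {n : ℕ} (t : ℕ) {p : Fin n → ℝ} (hp : p ∈ stdSimplex ℝ (Fin n)) :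
    EU t p = ∑ i, atomTerm t (p i) := by
  have := isProbabilityMeasure_atomicMeasure hp
  have hreal : ∀ i, (atomicMeasure p).real {i} = p i := fun i => by
    rw [measureReal_def, atomicMeasure_apply_singleton, ENNReal.toReal_ofReal (hp.1 i)]
  have hmiss : ∀ X : Fin t → Fin n, missingMass (atomicMeasure p) X =
      ∑ i, p i * (Set.univ.pi fun _ : Fin t => ({i}ᶜ : Set (Fin n))).indicator 1 X := by
    intro X
    classical
    have : (Set.range X)ᶜ = ((Finset.univ.filter fun i => i ∉ Set.range X : Finset (Fin n)) :
        Set (Fin n)) := by ext i; simp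
    rw [missingMass, this, ← sum_measureReal_singleton, Finset.sum_filter]
    refine Finset.sum_congr rfl fun i _ => ?_
    rw [hreal]
    by_cases hi : i ∈ Set.range X
    · obtain ⟨j, rfl⟩ := hi
      have : X ∉ Set.univ.pi fun _ : Fin t => ({X j}ᶜ : Set (Fin n)) := by
        simp only [Set.mem_univ_pi, not_forall]
        exact ⟨j, by simp⟩
      simp [this]
    · have : X ∈ Set.univ.pi fun _ : Fin t => ({i}ᶜ : Set (Fin n)) := by
        simp only [Set.mem_univ_pi, Set.mem_compl_iff, Set.mem_singleton_iff]
        exact fun j hj => hi ⟨j, hj⟩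
      simp [this, hi]
  simp only [EU, expectedMissingMass, hmiss]
  rw [integral_finsetSum _ fun i _ => Integrable.of_finite]
  refine Finset.sum_congr rfl fun i _ => ?_
  rw [integral_const_mul, integral_indicator_one (Set.toFinite _).measurableSet, measureReal_def,
    Measure.pi_pi, Finset.prod_const, Finset.card_univ, Fintype.card_fin, ENNReal.toReal_pow,
    ← measureReal_def, probReal_compl_eq_one_sub (measurableSet_singleton i), hreal, atomTerm]

/-! ### Concavity and convexity of one atom's contribution -/

/-- The derivative of `atomTerm (k + 1)`. -/
def atomTermDeriv (k : ℕ) (x : ℝ) : ℝ := (1 - x) ^ k * (1 - (k + 2) * x)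

theorem hasDerivAt_atomTerm (k : ℕ) (x : ℝ) :
    HasDerivAt (atomTerm (k + 1)) (atomTermDeriv k x) x := by
  have h := (hasDerivAt_id x).mul (((hasDerivAt_id x).const_sub 1).pow (k + 1))
  refine h.congr_deriv ?_
  simp [atomTermDeriv]
  ring

theorem continuous_atomTerm (t : ℕ) : Continuous (atomTerm t) := by
  unfold atomTerm; fun_prop

theorem deriv_atomTerm (k : ℕ) : deriv (atomTerm (k + 1)) = atomTermDeriv k :=
  funext fun x => (hasDerivAt_atomTerm k x).deriv

/-- The factor `1 - x` avoids the exponent `k - 1`, so `k = 0` needs no separate form. -/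
theorem deriv_atomTermDeriv_mul (k : ℕ) (x : ℝ) :
    deriv (atomTermDeriv k) x * (1 - x) = (k + 1) * (1 - x) ^ k * ((k + 2) * x - 2) := by
  have h := ((((hasDerivAt_id x).const_sub 1).pow k)).mul
    (((hasDerivAt_id x).const_mul ((k : ℝ) + 2)).const_sub 1)
  have h' : HasDerivAt (atomTermDeriv k) _ x := h
  rw [h'.deriv]
  rcases k with _ | j
  · simp; ring
  · simp [pow_succ]; ring

theorem strictConcaveOn_atomTerm (k : ℕ) :
    StrictConcaveOn ℝ (Set.Icc 0 (2 / ((k : ℝ) + 2))) (atomTerm (k + 1)) := by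
  refine strictConcaveOn_of_deriv2_neg (convex_Icc _ _) (continuous_atomTerm _).continuousOn ?_
  intro x hx
  rw [interior_Icc] at hx
  have hk : (0 : ℝ) < k + 2 := by positivity
  have h2 : x * (k + 2) < 2 := (lt_div_iff₀ hk).1 hx.2
  have hx1 : x < 1 := by nlinarith [hx.1, (Nat.cast_nonneg k : (0 : ℝ) ≤ k)]
  have h := deriv_atomTermDeriv_mul k x
  simp only [Function.iterate_succ, Function.iterate_zero, Function.comp, id]
  rw [deriv_atomTerm]
  have hneg : (k + 1) * (1 - x) ^ k * ((k + 2) * x - 2) < 0 :=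
    mul_neg_of_pos_of_neg (mul_pos (by positivity) (pow_pos (by linarith) _)) (by linarith)
  rw [← h] at hneg
  exact neg_of_mul_neg_left hneg (by linarith)

theorem strictConvexOn_atomTerm (k : ℕ) :
    StrictConvexOn ℝ (Set.Icc (2 / ((k : ℝ) + 2)) 1) (atomTerm (k + 1)) := by
  refine strictConvexOn_of_deriv2_pos (convex_Icc _ _) (continuous_atomTerm _).continuousOn ?_
  intro x hx
  rw [interior_Icc] at hx
  have hk : (0 : ℝ) < k + 2 := by positivity
  have h2 : 2 < x * (k + 2) := (div_lt_iff₀ hk).1 hx.1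
  have h := deriv_atomTermDeriv_mul k x
  simp only [Function.iterate_succ, Function.iterate_zero, Function.comp, id]
  rw [deriv_atomTerm]
  have hpos : 0 < (k + 1) * (1 - x) ^ k * ((k + 2) * x - 2) :=
    mul_pos (mul_pos (by positivity) (pow_pos (by linarith [hx.2]) _)) (by linarith)
  rw [← h] at hpos
  exact pos_of_mul_pos_left hpos (by linarith [hx.2])

/-! ### Mass transfer and local maximizers -/

/-- The two shifted points are convex combinations of `a` and `b` with weights interchanged. -/
theorem StrictConcaveOn.add_lt_add_shift {s : Set ℝ} {f : ℝ → ℝ} (hf : StrictConcaveOn ℝ s f)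
    {a b ε : ℝ} (ha : a ∈ s) (hb : b ∈ s) (hε : 0 < ε) (hab : ε < b - a) :
    f a + f b < f (a + ε) + f (b - ε) := by
  have hba : 0 < b - a := by linarith
  set θ := ε / (b - a) with hθ
  have hθ0 : 0 < θ := by positivity
  have hθ1 : θ < 1 := (div_lt_one hba).2 hab
  have hθε : θ * (b - a) = ε := div_mul_cancel₀ _ hba.ne'
  have hne : a ≠ b := by intro h; simp [h] at hba
  have h1 := hf.2 ha hb hne (sub_pos.2 hθ1) hθ0 (sub_add_cancel 1 θ)
  have h2 := hf.2 ha hb hne hθ0 (sub_pos.2 hθ1) (add_sub_cancel θ 1)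
  simp only [smul_eq_mul] at h1 h2
  rw [show (1 - θ) * a + θ * b = a + ε by rw [← hθε]; ring] at h1
  rw [show θ * a + (1 - θ) * b = b - ε by rw [← hθε]; ring] at h2
  linarith

theorem StrictConvexOn.add_lt_add_spread {s : Set ℝ} {f : ℝ → ℝ} (hf : StrictConvexOn ℝ s f)
    {a b ε : ℝ} (ha : a - ε ∈ s) (hb : b + ε ∈ s) (hε : 0 < ε) (hab : a ≤ b) :
    f a + f b < f (a - ε) + f (b + ε) := by
  have h := hf.neg.add_lt_add_shift ha hb hε (by linarith)
  simp only [Pi.neg_apply, sub_add_cancel, add_sub_cancel_right] at h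
  linarith

/-- Moving a small mass from one atom to another does not increase `𝔼 U_t` at a local maximizer. -/
theorem IsLocalMaximizer.transfer_le {n t : ℕ} {p : Fin n → ℝ} (hp : IsLocalMaximizer t p)
    {i j : Fin n} (hij : i ≠ j) :
    ∃ δ > 0, ∀ ε, 0 < ε → ε < δ → ε ≤ p j →
      atomTerm t (p i + ε) + atomTerm t (p j - ε) ≤ atomTerm t (p i) + atomTerm t (p j) := by
  classical
  obtain ⟨hps, hmax⟩ := hp
  set c : ℝ → Fin n → ℝ := fun ε => p + ε • (Pi.single i 1 - Pi.single j 1) with hc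
  have hci : ∀ ε, c ε i = p i + ε := fun ε => by simp [hc, hij]
  have hcj : ∀ ε, c ε j = p j - ε := fun ε => by simp [hc, hij.symm]; ring
  have hcl : ∀ ε l, l ≠ i → l ≠ j → c ε l = p l := fun ε l h1 h2 => by simp [hc, h1, h2]
  have hcont : Continuous c := by fun_prop
  have hc0 : c 0 = p := by simp [hc]
  have hmem : ∀ ε, 0 ≤ ε → ε ≤ p j → c ε ∈ stdSimplex ℝ (Fin n) := by
    intro ε h0 h1
    refine ⟨fun l => ?_, ?_⟩
    · rcases eq_or_ne l i with rfl | hli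
      · rw [hci]; linarith [hps.1 l]
      rcases eq_or_ne l j with rfl | hlj
      · rw [hcj]; linarith
      rw [hcl ε l hli hlj]; exact hps.1 l
    · simp only [hc, Pi.add_apply, Pi.smul_apply, Pi.sub_apply, smul_eq_mul,
        Finset.sum_add_distrib, hps.2, ← Finset.mul_sum, Finset.sum_sub_distrib]
      simp
  have hsum : ∀ q : Fin n → ℝ, ∑ l, atomTerm t (q l) =
      atomTerm t (q i) + atomTerm t (q j) + ∑ l ∈ (Finset.univ.erase i).erase j,
        atomTerm t (q l) := by
    intro q
    rw [← Finset.add_sum_erase _ _ (Finset.mem_univ i),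
      ← Finset.add_sum_erase _ _ (Finset.mem_erase.2 ⟨hij.symm, Finset.mem_univ j⟩), add_assoc]
  rw [IsLocalMaxOn, IsMaxFilter, eventually_nhdsWithin_iff] at hmax
  have hev : ∀ᶠ ε in nhds (0 : ℝ), c ε ∈ stdSimplex ℝ (Fin n) → EU t (c ε) ≤ EU t p := by
    have := hcont.tendsto 0
    rw [hc0] at this
    exact this.eventually hmax
  obtain ⟨δ, hδ, hball⟩ := Metric.eventually_nhds_iff.1 hev
  refine ⟨δ, hδ, fun ε h0 h1 h2 => ?_⟩
  have hm := hmem ε h0.le h2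
  have h := hball (by simpa [abs_of_pos h0] using h1) hm
  rw [EU_eq_sum t hm, EU_eq_sum t hps, hsum, hsum p, hci, hcj,
    Finset.sum_congr rfl fun l hl => by
      rw [hcl ε l (Finset.ne_of_mem_erase (Finset.mem_of_mem_erase hl))
        (Finset.ne_of_mem_erase hl)]] at h
  linarith

/-- Unequal atoms in the concave range gain by levelling; an atom beyond `c` gains by giving mass to
one at least as heavy. So only a largest atom can exceed `c`. -/
theorem IsLocalMaximizer.exists_isHeavyAtom {n t : ℕ} (ht : 1 ≤ t) {p : Fin n → ℝ}
    (hp : IsLocalMaximizer t p) : ∃ h, IsHeavyAtom p h := by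
  obtain ⟨k, rfl⟩ := Nat.exists_eq_add_of_le' ht
  set c : ℝ := 2 / ((k : ℝ) + 2) with hc
  have hp0 := hp.1.1
  have hsum := hp.1.2
  have hlight : ∀ i j, p i ≤ c → p j ≤ c → ¬ p i < p j := by
    intro i j hi hj hlt
    obtain ⟨δ, hδ, h⟩ := hp.transfer_le (i := i) (j := j) (by rintro rfl; exact lt_irrefl _ hlt)
    obtain ⟨ε, hε0, hε⟩ := exists_between (lt_min hδ (sub_pos.2 hlt))
    have hε1 := hε.trans_le (min_le_left _ _)
    have hε2 := hε.trans_le (min_le_right _ _)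
    have := h ε hε0 hε1 (by linarith [hp0 i])
    have := (strictConcaveOn_atomTerm k).add_lt_add_shift ⟨hp0 i, hi⟩ ⟨hp0 j, hj⟩ hε0 hε2
    linarith
  have hheavy : ∀ i j, i ≠ j → c < p j → ¬ p j ≤ p i := by
    intro i j hij hj hle
    obtain ⟨δ, hδ, h⟩ := hp.transfer_le hij
    obtain ⟨ε, hε0, hε⟩ := exists_between (lt_min hδ (sub_pos.2 hj))
    have hε1 := hε.trans_le (min_le_left _ _)
    have hε2 := hε.trans_le (min_le_right _ _)
    have hc0 : 0 < c := by positivity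
    -- Keeps `p i + ε` inside the convexity interval, since `ε < p j - c`.
    have h2 : p i + p j ≤ 1 := by
      rw [← hsum, ← Finset.sum_pair hij]
      exact Finset.sum_le_sum_of_subset_of_nonneg (Finset.subset_univ _) fun l _ _ => hp0 l
    have := h ε hε0 hε1 (by linarith)
    have := (strictConvexOn_atomTerm k).add_lt_add_spread (a := p j) (b := p i) (ε := ε)
      ⟨by linarith, by linarith [hp0 i]⟩ ⟨by linarith, by linarith⟩ hε0 hle
    linarith
  have hne : Nonempty (Fin n) := by
    by_contra hn
    rw [not_nonempty_iff] at hn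
    simp at hsum
  obtain ⟨h, hh⟩ := Finite.exists_max p
  have hoth : ∀ i, i ≠ h → p i ≤ c := fun i hi => not_lt.1 fun hlt => hheavy h i hi.symm hlt (hh i)
  refine ⟨h, fun i j hi hj => le_antisymm ?_ ?_, hh⟩
  · exact not_lt.1 (hlight j i (hoth j hj) (hoth i hi))
  · exact not_lt.1 (hlight i j (hoth i hi) (hoth j hj))

/-! ### Reduction to one parameter -/

/-- The distribution on `m + 1` points with mass `x` at every point other than `h`. -/
def heavyVector (m : ℕ) (h : Fin (m + 1)) (x : ℝ) : Fin (m + 1) → ℝ :=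
  fun i => if i = h then 1 - m * x else x

/-- The expected missing mass of `heavyVector m h x`. -/
def heavyMass (m t : ℕ) (x : ℝ) : ℝ := m * atomTerm t x + atomTerm t (1 - m * x)

theorem sum_comp_heavyVector (m : ℕ) (h : Fin (m + 1)) (x : ℝ) (f : ℝ → ℝ) :
    ∑ i, f (heavyVector m h x i) = m * f x + f (1 - m * x) := by
  rw [← Finset.add_sum_erase _ _ (Finset.mem_univ h), Finset.sum_congr rfl fun i hi => by
    rw [heavyVector, if_neg (Finset.ne_of_mem_erase hi)]]
  simp [heavyVector, add_comm]

theorem mul_le_of_mem_Icc {m : ℕ} {x : ℝ} (hx : x ∈ Set.Icc 0 (1 / ((m : ℝ) + 1))) :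
    ((m : ℝ) + 1) * x ≤ 1 := by
  have := (le_div_iff₀ (by positivity : (0 : ℝ) < m + 1)).1 hx.2
  linarith

theorem heavyVector_mem_stdSimplex {m : ℕ} (h : Fin (m + 1)) {x : ℝ}
    (hx : x ∈ Set.Icc 0 (1 / ((m : ℝ) + 1))) : heavyVector m h x ∈ stdSimplex ℝ (Fin (m + 1)) := by
  have := mul_le_of_mem_Icc hx
  refine ⟨fun i => ?_, ?_⟩
  · unfold heavyVector
    split_ifs
    · linarith [hx.1]
    · exact hx.1
  · have := sum_comp_heavyVector m h x id
    simp only [id] at this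
    rw [this]; ring

theorem EU_heavyVector {m : ℕ} (t : ℕ) (h : Fin (m + 1)) {x : ℝ}
    (hx : x ∈ Set.Icc 0 (1 / ((m : ℝ) + 1))) : EU t (heavyVector m h x) = heavyMass m t x := by
  rw [EU_eq_sum t (heavyVector_mem_stdSimplex h hx), sum_comp_heavyVector, heavyMass]

theorem heavyVector_uniform (m : ℕ) (h : Fin (m + 1)) :
    heavyVector m h (1 / ((m : ℝ) + 1)) = fun _ => 1 / ((m + 1 : ℕ) : ℝ) := by
  funext i
  have : (m : ℝ) + 1 ≠ 0 := by positivity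
  unfold heavyVector
  split_ifs
  · push_cast; field_simp; ring
  · push_cast; rfl

theorem IsHeavyAtom.eq_heavyVector {m : ℕ} (hm : 1 ≤ m) {p : Fin (m + 1) → ℝ}
    (hp : p ∈ stdSimplex ℝ (Fin (m + 1))) {h : Fin (m + 1)} (hh : IsHeavyAtom p h) :
    ∃ x ∈ Set.Icc 0 (1 / ((m : ℝ) + 1)), p = heavyVector m h x := by
  have : Nontrivial (Fin (m + 1)) := Fin.nontrivial_iff_two_le.2 (by omega)
  obtain ⟨i, hi⟩ := exists_ne h
  have hsum : m * p i + p h = 1 := by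
    rw [← hp.2, ← Finset.add_sum_erase _ _ (Finset.mem_univ h),
      Finset.sum_congr rfl fun j hj => hh.1 j i (Finset.ne_of_mem_erase hj) hi]
    simp [add_comm]
  refine ⟨p i, ⟨hp.1 i, ?_⟩, funext fun j => ?_⟩
  · rw [le_div_iff₀ (by positivity)]
    linarith [hh.2 i]
  · unfold heavyVector
    split_ifs with hj
    · subst hj; linarith
    · exact hh.1 j i hj hi

theorem continuousOn_EU (n t : ℕ) : ContinuousOn (EU t) (stdSimplex ℝ (Fin n)) := by
  have : ContinuousOn (fun p : Fin n → ℝ => ∑ i, atomTerm t (p i)) (stdSimplex ℝ (Fin n)) :=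
    (continuous_finsetSum _ fun i _ =>
      (continuous_atomTerm t).comp (continuous_apply i)).continuousOn
  exact this.congr fun p hp => EU_eq_sum t hp

theorem exists_isGlobalMaximizer {n : ℕ} (hn : 1 ≤ n) (t : ℕ) :
    ∃ p : Fin n → ℝ, IsGlobalMaximizer t p := by
  have : Nonempty (Fin n) := ⟨⟨0, hn⟩⟩
  obtain ⟨p, hp, hmax⟩ := (isCompact_stdSimplex ℝ (Fin n)).exists_isMaxOn
    ⟨_, single_mem_stdSimplex ℝ (⟨0, hn⟩ : Fin n)⟩ (continuousOn_EU n t)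
  exact ⟨p, hp, hmax⟩

theorem IsGlobalMaximizer.exists_eq_heavyVector {m t : ℕ} (hm : 1 ≤ m) (ht : 1 ≤ t)
    {p : Fin (m + 1) → ℝ} (hp : IsGlobalMaximizer t p) :
    ∃ h, ∃ x ∈ Set.Icc 0 (1 / ((m : ℝ) + 1)), p = heavyVector m h x ∧
      IsMaxOn (heavyMass m t) (Set.Icc 0 (1 / ((m : ℝ) + 1))) x := by
  obtain ⟨h, hh⟩ := IsLocalMaximizer.exists_isHeavyAtom ht ⟨hp.1, hp.2.localize⟩
  obtain ⟨x, hx, rfl⟩ := hh.eq_heavyVector hm hp.1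
  refine ⟨h, x, hx, rfl, fun z hz => ?_⟩
  have := hp.2 (heavyVector_mem_stdSimplex h hz)
  simpa only [Set.mem_ofPred_eq, EU_heavyVector t h hx, EU_heavyVector t h hz] using this

/-- Compactness supplies some global maximizer, which is itself a heavy vector; beating that one
suffices. -/
theorem isGlobalMaximizer_heavyVector {m t : ℕ} (hm : 1 ≤ m) (ht : 1 ≤ t) (h : Fin (m + 1))
    {x : ℝ} (hx : x ∈ Set.Icc 0 (1 / ((m : ℝ) + 1)))
    (hmax : IsMaxOn (heavyMass m t) (Set.Icc 0 (1 / ((m : ℝ) + 1))) x) :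
    IsGlobalMaximizer t (heavyVector m h x) := by
  refine ⟨heavyVector_mem_stdSimplex h hx, fun q hq => ?_⟩
  obtain ⟨p, hp⟩ := exists_isGlobalMaximizer (n := m + 1) (by omega) t
  obtain ⟨h', x', hx', rfl, -⟩ := hp.exists_eq_heavyVector hm ht
  have h1 : EU t q ≤ _ := hp.2 hq
  have h2 : heavyMass m t x' ≤ _ := hmax hx'
  rw [EU_heavyVector t h' hx'] at h1
  rw [Set.mem_ofPred_eq, EU_heavyVector t h hx]
  exact h1.trans h2

/-! ### Critical points in the ratio coordinate -/

theorem hasDerivAt_heavyMass (m k : ℕ) (x : ℝ) :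
    HasDerivAt (heavyMass m (k + 1))
      (m * (atomTermDeriv k x - atomTermDeriv k (1 - m * x))) x := by
  have h1 := (hasDerivAt_atomTerm k x).const_mul (m : ℝ)
  have h2 := (hasDerivAt_atomTerm k (1 - m * x)).comp x
    (((hasDerivAt_id x).const_mul (m : ℝ)).const_sub 1)
  refine (h1.add h2).congr_deriv ?_
  simp; ring

/-- Up to a positive factor, the derivative of `heavyMass m (k + 1)` in the coordinate
`r = m x / (1 - x)`. -/
def massSlope (m k : ℕ) (r : ℝ) : ℝ :=
  m - (k + 1) * r + (k + 1) * m * r ^ k - (m * (k + 1) + m - (k + 1)) * r ^ (k + 1)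

/-- Exhibits the root `1` and, for `m ≤ k + 1`, isolates the only negative term on `[0, 1]`: it is
proportional to the excess `t - m`, where `t = k + 1`. -/
theorem massSlope_eq (m k : ℕ) (r : ℝ) : massSlope m k r =
    (1 - r) * (m + (k + 1) * m * r ^ k) - (k + 1 - m) * r * (1 - r ^ k) := by
  unfold massSlope; ring

theorem massSlope_one (m k : ℕ) : massSlope m k 1 = 0 := by simp [massSlope_eq]

theorem deriv_heavyMass_eq (m k : ℕ) {x : ℝ} (hx : x < 1) :
    m * (atomTermDeriv k x - atomTermDeriv k (1 - m * x)) =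
      (1 - x) ^ (k + 1) * massSlope m k (m * x / (1 - x)) := by
  have h : 1 - x ≠ 0 := by linarith
  unfold massSlope atomTermDeriv
  rw [div_pow, div_pow, sub_sub_cancel]
  field_simp
  ring

theorem continuous_massSlope (m k : ℕ) : Continuous (massSlope m k) := by
  unfold massSlope; fun_prop

theorem hasDerivAt_massSlope (m k : ℕ) (r : ℝ) :
    HasDerivAt (massSlope m (k + 2)) (-(k + 3) + (k + 3) * (k + 2) * m * r ^ (k + 1) -
      (k + 3) * (m * (k + 3) + m - (k + 3)) * r ^ (k + 2)) r := by
  unfold massSlope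
  have h := ((((hasDerivAt_id r).const_mul (((k + 2 : ℕ) : ℝ) + 1)).const_sub (m : ℝ)).add
    ((hasDerivAt_pow (k + 2) r).const_mul ((((k + 2 : ℕ) : ℝ) + 1) * m))).sub
    ((hasDerivAt_pow (k + 2 + 1) r).const_mul
      (m * (((k + 2 : ℕ) : ℝ) + 1) + m - (((k + 2 : ℕ) : ℝ) + 1)))
  refine h.congr_deriv ?_
  push_cast
  simp
  ring

/-- Apart from `1`, the function `massSlope` has at most two zeros in `(0, 1)`. -/
theorem massSlope_no_three_zeros {m k : ℕ} (hm : 1 ≤ m) {r₀ r₁ r₂ : ℝ} (h0 : 0 < r₀) (h01 : r₀ < r₁)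
    (h12 : r₁ < r₂) (h2 : r₂ < 1) (hr₀ : massSlope m (k + 2) r₀ = 0) (hr₁ : massSlope m (k + 2) r₁ = 0)
    (hr₂ : massSlope m (k + 2) r₂ = 0) : False := by
  have hder := hasDerivAt_massSlope m k
  -- With the zero at `1` there are four zeros, hence two positive zeros of the second derivative,
  -- which is a positive factor times a linear one.
  have rolle : ∀ a b, a < b → massSlope m (k + 2) a = 0 → massSlope m (k + 2) b = 0 →
      ∃ c ∈ Set.Ioo a b, -((k : ℝ) + 3) + (k + 3) * (k + 2) * m * c ^ (k + 1) -
        (k + 3) * (m * (k + 3) + m - (k + 3)) * c ^ (k + 2) = 0 := fun a b hab ha hb =>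
    exists_hasDerivAt_eq_zero hab (continuous_massSlope m (k + 2)).continuousOn (ha.trans hb.symm)
      fun x _ => hder x
  obtain ⟨s₀, hs₀, e₀⟩ := rolle _ _ h01 hr₀ hr₁
  obtain ⟨s₁, hs₁, e₁⟩ := rolle _ _ h12 hr₁ hr₂
  obtain ⟨s₂, hs₂, e₂⟩ := rolle _ _ h2 hr₂ (massSlope_one m _)
  have hder2 : ∀ r : ℝ, HasDerivAt (fun c : ℝ => -((k : ℝ) + 3) + (k + 3) * (k + 2) * m * c ^ (k + 1) -
        (k + 3) * (m * (k + 3) + m - (k + 3)) * c ^ (k + 2))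
      ((k + 3) * (k + 2) * r ^ k * (m * (k + 1) - (m * (k + 3) + m - (k + 3)) * r)) r := by
    intro r
    have h := (((hasDerivAt_pow (k + 1) r).const_mul (((k : ℝ) + 3) * (k + 2) * m)).const_add
      (-((k : ℝ) + 3))).sub
      ((hasDerivAt_pow (k + 2) r).const_mul (((k : ℝ) + 3) * (m * (k + 3) + m - (k + 3))))
    refine h.congr_deriv ?_
    push_cast
    ring
  have rolle2 : ∀ a b : ℝ, 0 < a → a < b →
      -((k : ℝ) + 3) + (k + 3) * (k + 2) * m * a ^ (k + 1) -
        (k + 3) * (m * (k + 3) + m - (k + 3)) * a ^ (k + 2) = 0 →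
      -((k : ℝ) + 3) + (k + 3) * (k + 2) * m * b ^ (k + 1) -
        (k + 3) * (m * (k + 3) + m - (k + 3)) * b ^ (k + 2) = 0 →
      ∃ c ∈ Set.Ioo a b, (m : ℝ) * (k + 1) - (m * (k + 3) + m - (k + 3)) * c = 0 := by
    intro a b h0 hab ha hb
    obtain ⟨c, hc, e⟩ := exists_hasDerivAt_eq_zero hab (by fun_prop) (ha.trans hb.symm)
      fun x _ => hder2 x
    refine ⟨c, hc, (mul_eq_zero.1 e).resolve_left ?_⟩
    have : 0 < c := h0.trans hc.1
    positivity
  obtain ⟨u, hu, eu⟩ := rolle2 s₀ s₁ (h0.trans hs₀.1) (hs₀.2.trans hs₁.1) e₀ e₁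
  obtain ⟨v, hv, ev⟩ := rolle2 s₁ s₂ (h0.trans (h01.trans hs₁.1)) (hs₁.2.trans hs₂.1) e₁ e₂
  have huv : u < v := hu.2.trans hv.1
  have hcoef : ((m : ℝ) * (k + 3) + m - (k + 3)) * (v - u) = 0 := by linarith
  have hcoef := (mul_eq_zero.1 hcoef).resolve_right (by linarith)
  rw [hcoef] at eu
  have : (0 : ℝ) < m * (k + 1) := by
    have : (1 : ℝ) ≤ m := by exact_mod_cast hm
    positivity
  linarith

theorem lt_one_of_mem_Icc {m : ℕ} (hm : 1 ≤ m) {x : ℝ}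
    (hx : x ∈ Set.Icc 0 (1 / ((m : ℝ) + 1))) : x < 1 := by
  have h := mul_le_of_mem_Icc hx
  have : (1 : ℝ) ≤ m := by exact_mod_cast hm
  nlinarith [hx.1]

theorem ratio_lt_ratio {m : ℕ} (hm : 1 ≤ m) {x y : ℝ} (hxy : x < y) (hy : y < 1) :
    m * x / (1 - x) < m * y / (1 - y) := by
  have : (0 : ℝ) < m := by exact_mod_cast hm
  rw [div_lt_div_iff₀ (by linarith) (by linarith)]
  nlinarith

theorem ratio_lt_one {m : ℕ} {x : ℝ} (hx : x < 1) (h : x < 1 / ((m : ℝ) + 1)) :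
    m * x / (1 - x) < 1 := by
  rw [lt_div_iff₀ (by positivity)] at h
  rw [div_lt_one (by linarith)]
  linarith

theorem uniform_mem_Icc (m : ℕ) :
    1 / ((m : ℝ) + 1) ∈ Set.Icc 0 (1 / ((m : ℝ) + 1)) := ⟨by positivity, le_rfl⟩

theorem heavyMass_uniform (m t : ℕ) :
    heavyMass m t (1 / ((m : ℝ) + 1)) = (m / ((m : ℝ) + 1)) ^ t := by
  have h : (m : ℝ) + 1 ≠ 0 := by positivity
  have h1 : 1 - 1 / ((m : ℝ) + 1) = m / (m + 1) := by field_simp; ring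
  have h2 : m * (1 / ((m : ℝ) + 1)) = m / (m + 1) := by field_simp
  have h3 : 1 - m / ((m : ℝ) + 1) = 1 / (m + 1) := by field_simp; ring
  rw [heavyMass, atomTerm, atomTerm, h1, h2, sub_sub_cancel, h3]
  field_simp

theorem IsMaxOn.heavyMass_pos {m t : ℕ} (hm : 1 ≤ m) (ht : 1 ≤ t) {x : ℝ}
    (hx : x ∈ Set.Icc 0 (1 / ((m : ℝ) + 1)))
    (hmax : IsMaxOn (heavyMass m t) (Set.Icc 0 (1 / ((m : ℝ) + 1))) x) : 0 < x := by
  rcases hx.1.lt_or_eq with h | rfl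
  · exact h
  · have h : heavyMass m t _ ≤ _ := hmax (uniform_mem_Icc m)
    have h0 : heavyMass m t 0 = 0 := by simp [heavyMass, atomTerm, Nat.ne_of_gt ht]
    rw [heavyMass_uniform, h0] at h
    have : (0 : ℝ) < m := by exact_mod_cast hm
    have : 0 < ((m : ℝ) / (m + 1)) ^ t := by positivity
    linarith

theorem massSlope_ratio_eq_zero {m k : ℕ} {x : ℝ} (hx : x < 1)
    (h : m * (atomTermDeriv k x - atomTermDeriv k (1 - m * x)) = 0) :
    massSlope m k (m * x / (1 - x)) = 0 := by
  rw [deriv_heavyMass_eq m k hx] at h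
  exact (mul_eq_zero.1 h).resolve_left (pow_ne_zero _ (by linarith))

theorem IsMaxOn.deriv_heavyMass_eq_zero {m k : ℕ} (hm : 1 ≤ m) {x : ℝ}
    (hx : x ∈ Set.Icc 0 (1 / ((m : ℝ) + 1))) (hne : x ≠ 1 / ((m : ℝ) + 1))
    (hmax : IsMaxOn (heavyMass m (k + 1)) (Set.Icc 0 (1 / ((m : ℝ) + 1))) x) :
    m * (atomTermDeriv k x - atomTermDeriv k (1 - m * x)) = 0 := by
  have hx0 := IsMaxOn.heavyMass_pos hm (by omega) hx hmax
  exact (hmax.isLocalMax (Icc_mem_nhds hx0 (lt_of_le_of_ne hx.2 hne))).hasDerivAt_eq_zero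
    (hasDerivAt_heavyMass m k x)

/-- There is at most one non-uniform maximizer. -/
theorem IsMaxOn.heavyMass_unique {m k : ℕ} (hm : 1 ≤ m) {x y : ℝ}
    (hx : x ∈ Set.Icc 0 (1 / ((m : ℝ) + 1))) (hy : y ∈ Set.Icc 0 (1 / ((m : ℝ) + 1)))
    (hxu : x ≠ 1 / ((m : ℝ) + 1)) (hyu : y ≠ 1 / ((m : ℝ) + 1))
    (hxm : IsMaxOn (heavyMass m (k + 3)) (Set.Icc 0 (1 / ((m : ℝ) + 1))) x)
    (hym : IsMaxOn (heavyMass m (k + 3)) (Set.Icc 0 (1 / ((m : ℝ) + 1))) y) : x = y := by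
  wlog hxy : x < y generalizing x y
  · rcases lt_trichotomy x y with h | h | h
    · exact absurd h hxy
    · exact h
    · exact (this hy hx hyu hxu hym hxm h).symm
  exfalso
  have hy1 := lt_one_of_mem_Icc hm hy
  have hx0 := IsMaxOn.heavyMass_pos hm (by omega) hx hxm
  -- The two maximal values agree, so Rolle supplies the third critical point.
  obtain ⟨c, hc, hc0⟩ := exists_hasDerivAt_eq_zero hxy
    (fun z _ => (hasDerivAt_heavyMass m (k + 2) z).continuousAt.continuousWithinAt)
    (le_antisymm (hym hx) (hxm hy)) fun z _ => hasDerivAt_heavyMass m (k + 2) z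
  have hm0 : (0 : ℝ) < m := by exact_mod_cast hm
  refine massSlope_no_three_zeros hm (by have := hxy.trans hy1; apply div_pos <;> nlinarith)
    (ratio_lt_ratio hm hc.1 (hc.2.trans hy1)) (ratio_lt_ratio hm hc.2 hy1)
    (ratio_lt_one hy1 (lt_of_le_of_ne hy.2 hyu))
    (massSlope_ratio_eq_zero (hxy.trans hy1) (IsMaxOn.deriv_heavyMass_eq_zero hm hx hxu hxm))
    (massSlope_ratio_eq_zero (hc.2.trans hy1) hc0)
    (massSlope_ratio_eq_zero hy1 (IsMaxOn.deriv_heavyMass_eq_zero hm hy hyu hym))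

theorem heavyMass_le_uniform_of_massSlope_nonneg {m k : ℕ} (hm : 1 ≤ m) {x : ℝ}
    (hx : x ∈ Set.Icc 0 (1 / ((m : ℝ) + 1)))
    (h : ∀ r, m * x / (1 - x) < r → r < 1 → 0 ≤ massSlope m k r) :
    heavyMass m (k + 1) x ≤ heavyMass m (k + 1) (1 / ((m : ℝ) + 1)) := by
  have hmono : MonotoneOn (heavyMass m (k + 1)) (Set.Icc x (1 / ((m : ℝ) + 1))) := by
    refine monotoneOn_of_deriv_nonneg (convex_Icc _ _)
      (fun z _ => (hasDerivAt_heavyMass m k z).continuousAt.continuousWithinAt)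
      (fun z _ => (hasDerivAt_heavyMass m k z).differentiableAt.differentiableWithinAt) ?_
    intro z hz
    rw [interior_Icc] at hz
    have hz1 := lt_one_of_mem_Icc hm ⟨hx.1.trans hz.1.le, hz.2.le⟩
    rw [(hasDerivAt_heavyMass m k z).deriv, deriv_heavyMass_eq m k hz1]
    exact mul_nonneg (pow_nonneg (by linarith) _)
      (h _ (ratio_lt_ratio hm hz.1 hz1) (ratio_lt_one hz1 hz.2))
  exact hmono ⟨le_rfl, hx.2⟩ ⟨hx.2, le_rfl⟩ hx.2

/-! ### Comparison with the uniform value as `t` grows -/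

theorem heavyMass_eq_uniform_mul {m : ℕ} (hm : 1 ≤ m) (t : ℕ) (x : ℝ) :
    heavyMass m t x = heavyMass m t (1 / ((m : ℝ) + 1)) *
      (m * x * ((1 - x) * (m + 1) / m) ^ t + (1 - m * x) * ((m + 1) * x) ^ t) := by
  have hm0 : (m : ℝ) ≠ 0 := by positivity
  have h1 : ((m : ℝ) / (m + 1)) ^ t * ((1 - x) * (m + 1) / m) ^ t = (1 - x) ^ t := by
    rw [← mul_pow]; congr 1; field_simp
  have h2 : ((m : ℝ) / (m + 1)) ^ t * ((m + 1) * x) ^ t = (m * x) ^ t := by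
    rw [← mul_pow]; congr 1; field_simp
  rw [heavyMass_uniform, heavyMass, atomTerm, atomTerm, sub_sub_cancel]
  linear_combination (-(m * x)) * h1 - (1 - m * x) * h2

/-- With `S t` the weighted sum, `a ^ t - 1 < t a ^ t (a - 1)` and `t b ^ t (1 - b) ≤ 1 - b ^ t`
combine to `t (S (t+1) - S t) > S t - 1 ≥ 0`. -/
theorem add_mul_pow_lt_succ {w₁ w₂ a b : ℝ} {t : ℕ} (ht : 1 ≤ t) (hw₁ : 0 < w₁) (hw₂ : 0 ≤ w₂)
    (hw : w₁ + w₂ = 1) (ha : 1 < a) (hb : 0 ≤ b) (hb1 : b ≤ 1)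
    (h : 1 ≤ w₁ * a ^ t + w₂ * b ^ t) : w₁ * a ^ t + w₂ * b ^ t < w₁ * a ^ (t + 1) + w₂ * b ^ (t + 1) := by
  have ht0 : (0 : ℝ) < t := by exact_mod_cast ht
  have hA : a ^ t - 1 < t * a ^ t * (a - 1) := by
    rw [← geom_sum_mul]
    refine mul_lt_mul_of_pos_right ?_ (by linarith)
    calc ∑ i ∈ Finset.range t, a ^ i < ∑ i ∈ Finset.range t, a ^ t :=
          Finset.sum_lt_sum_of_nonempty ⟨0, Finset.mem_range.2 ht⟩ fun i hi =>
            pow_lt_pow_right₀ ha (Finset.mem_range.1 hi)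
      _ = t * a ^ t := by simp
  have hB : t * b ^ t * (1 - b) ≤ 1 - b ^ t := by
    have := geom_sum_mul b t
    have h1 : t * b ^ t ≤ ∑ i ∈ Finset.range t, b ^ i := by
      calc t * b ^ t = ∑ i ∈ Finset.range t, b ^ t := by simp
        _ ≤ _ := Finset.sum_le_sum fun i hi =>
            pow_le_pow_of_le_one hb hb1 (Finset.mem_range.1 hi).le
    have := mul_le_mul_of_nonneg_right h1 (sub_nonneg.2 hb1)
    linarith
  have h1 : w₁ * (a ^ t - 1) < w₁ * (t * a ^ t * (a - 1)) := mul_lt_mul_of_pos_left hA hw₁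
  have h2 := mul_le_mul_of_nonneg_left hB hw₂
  have h3 : 0 < t * ((w₁ * a ^ (t + 1) + w₂ * b ^ (t + 1)) - (w₁ * a ^ t + w₂ * b ^ t)) := by
    rw [pow_succ, pow_succ]
    nlinarith
  have := pos_of_mul_pos_right h3 ht0.le
  linarith

/-- If a non-uniform distribution is at least as good as the uniform one, it is strictly better for
larger samples. -/
theorem heavyMass_uniform_lt_succ {m t : ℕ} (hm : 1 ≤ m) (ht : 1 ≤ t) {x : ℝ}
    (hx : x ∈ Set.Icc 0 (1 / ((m : ℝ) + 1))) (hne : x ≠ 1 / ((m : ℝ) + 1))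
    (h : heavyMass m t (1 / ((m : ℝ) + 1)) ≤ heavyMass m t x) :
    heavyMass m (t + 1) (1 / ((m : ℝ) + 1)) < heavyMass m (t + 1) x := by
  have hm0 : (0 : ℝ) < m := by exact_mod_cast hm
  have hpos : ∀ t, 0 < heavyMass m t (1 / ((m : ℝ) + 1)) := fun t => by
    rw [heavyMass_uniform]; positivity
  have hlt : (m + 1) * x < 1 := by
    have := lt_of_le_of_ne hx.2 hne
    rw [lt_div_iff₀ (by positivity)] at this
    linarith
  have hx0 : 0 < x := by
    rcases hx.1.lt_or_eq with h' | rfl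
    · exact h'
    · have h0 : heavyMass m t 0 = 0 := by simp [heavyMass, atomTerm, Nat.ne_of_gt ht]
      linarith [hpos t]
  rw [heavyMass_eq_uniform_mul hm t x, le_mul_iff_one_le_right (hpos t)] at h
  rw [heavyMass_eq_uniform_mul hm (t + 1) x, lt_mul_iff_one_lt_right (hpos _)]
  refine h.trans_lt (add_mul_pow_lt_succ ht (by positivity) (by linarith) (by ring) ?_
    (by positivity) hlt.le h)
  rw [lt_div_iff₀ hm0]
  linarith

theorem heavyMass_uniform_lt_of_lt {m t s : ℕ} (hm : 1 ≤ m) (ht : 1 ≤ t) (hts : t < s) {x : ℝ}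
    (hx : x ∈ Set.Icc 0 (1 / ((m : ℝ) + 1))) (hne : x ≠ 1 / ((m : ℝ) + 1))
    (h : heavyMass m t (1 / ((m : ℝ) + 1)) ≤ heavyMass m t x) :
    heavyMass m s (1 / ((m : ℝ) + 1)) < heavyMass m s x := by
  induction s, hts using Nat.le_induction with
  | base => exact heavyMass_uniform_lt_succ hm ht hx hne h
  | succ s hs ih => exact heavyMass_uniform_lt_succ hm (by omega) hx hne ih.le

/-! ### Uniform optimality at `t = n + 1` -/

/-- Pair the exponents `i` and `n + 1 - i`: `(1 - r ^ i) (1 - r ^ (n + 1 - i)) ≥ 0`. -/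
theorem two_mul_sum_pow_le {r : ℝ} (hr : 0 ≤ r) (hr1 : r ≤ 1) (n : ℕ) :
    2 * ∑ j ∈ Finset.range n, r ^ (j + 1) ≤ n * (1 + r ^ (n + 1)) := by
  have hrefl := Finset.sum_range_reflect (fun j => r ^ (j + 1)) n
  have : 2 * ∑ j ∈ Finset.range n, r ^ (j + 1) =
      ∑ j ∈ Finset.range n, (r ^ (n - 1 - j + 1) + r ^ (j + 1)) := by
    rw [Finset.sum_add_distrib, hrefl]; ring
  rw [this]
  calc _ ≤ ∑ j ∈ Finset.range n, (1 + r ^ (n + 1)) := Finset.sum_le_sum fun j hj => ?_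
    _ = _ := by rw [Finset.sum_const, Finset.card_range, nsmul_eq_mul]
  have hj := Finset.mem_range.1 hj
  have : r ^ (n + 1) = r ^ (n - 1 - j + 1) * r ^ (j + 1) := by rw [← pow_add]; congr 1; omega
  rw [this]
  nlinarith [pow_le_one₀ hr hr1 (n := n - 1 - j + 1), pow_le_one₀ hr hr1 (n := j + 1)]

/-- Here `t - m = 2`. Factoring out `1 - r` and pairing powers leaves at least `(m - 1) (m + 2) r ^
(m + 1)`. -/
theorem massSlope_nonneg {m : ℕ} (hm : 1 ≤ m) {r : ℝ} (hr : 0 ≤ r) (hr1 : r ≤ 1) :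
    0 ≤ massSlope m (m + 1) r := by
  have hm' : (1 : ℝ) ≤ m := by exact_mod_cast hm
  have hgeom : (∑ j ∈ Finset.range m, r ^ (j + 1) + r ^ (m + 1)) * (1 - r) =
      r * (1 - r ^ (m + 1)) := by
    have := geom_sum_mul r (m + 1)
    rw [← Finset.sum_range_succ (fun j => r ^ (j + 1))]
    simp only [pow_succ, ← Finset.sum_mul] at this ⊢
    linear_combination (-r) * this
  have hle := two_mul_sum_pow_le hr hr1 m
  have : massSlope m (m + 1) r = (1 - r) * (m + (m + 2) * m * r ^ (m + 1) -
      2 * (∑ j ∈ Finset.range m, r ^ (j + 1) + r ^ (m + 1))) := by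
    rw [massSlope_eq]
    push_cast
    linear_combination 2 * hgeom
  rw [this]
  have hp : 0 ≤ r ^ (m + 1) := by positivity
  exact mul_nonneg (by linarith)
    (by nlinarith [mul_nonneg (mul_nonneg (sub_nonneg.2 hm') (by linarith : (0 : ℝ) ≤ m + 2)) hp])

theorem isMaxOn_heavyMass_uniform {m : ℕ} (hm : 1 ≤ m) :
    IsMaxOn (heavyMass m (m + 2)) (Set.Icc 0 (1 / ((m : ℝ) + 1))) (1 / ((m : ℝ) + 1)) := by
  intro x hx
  refine heavyMass_le_uniform_of_massSlope_nonneg hm hx fun r hr hr1 => massSlope_nonneg hm ?_ hr1.le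
  have := lt_one_of_mem_Icc hm hx
  exact (div_nonneg (mul_nonneg m.cast_nonneg hx.1) (by linarith)).trans hr.le

/-! ### Uniform distribution beaten from `n + √(2n)` on -/

theorem cubic_le_one_add_pow {q : ℝ} (hq : 0 ≤ q) (t : ℕ) :
    1 + t * q + t * (t - 1) / 2 * q ^ 2 + t * (t - 1) * (t - 2) / 6 * q ^ 3 ≤ (1 + q) ^ t := by
  induction t with
  | zero => simp
  | succ t ih =>
    have h3 : (0 : ℝ) ≤ t * (t - 1) * (t - 2) := by
      rcases t with _ | _ | j
      · simp
      · simp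
      · push_cast
        have : (0 : ℝ) ≤ j := j.cast_nonneg
        exact mul_nonneg (mul_nonneg (by linarith) (by linarith)) (by linarith)
    have h4 : 0 ≤ (t : ℝ) * (t - 1) * (t - 2) / 6 * q ^ 4 := by positivity
    have := mul_le_mul_of_nonneg_right ih (by linarith : 0 ≤ 1 + q)
    rw [pow_succ (1 + q)]
    push_cast
    linarith

/-- Numerator of the cubic binomial truncation minus `T / m`, at `q = e / (m T)`. Putting `k = 1 +
z` makes every coefficient in `z` and `d` positive. -/
theorem cubic_excess_pos {k d n m t e T : ℝ} (hk : 1 ≤ k) (hd : 0 ≤ d) (hn : n = 2 * k ^ 2)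
    (hm : m = n - 1) (ht : t = n + 2 * k + d) (he : e = t - m) (hT : T = t + 1) :
    0 < 3 * t * (t - 1) * T * e ^ 2 * m + t * (t - 1) * (t - 2) * e ^ 3 -
      6 * T ^ 2 * m ^ 2 * (T + e) := by
  obtain ⟨z, hz, rfl⟩ : ∃ z, 0 ≤ z ∧ k = 1 + z := ⟨k - 1, by linarith, by ring⟩
  subst hT he ht hm hn
  ring_nf
  positivity

/-- The condition `B < A * exp y` of `exists_massSlope_neg`, with `exp` cut at degree five and
multiplied by `t - 1`. -/
theorem exp_margin_pos {k d n m t y : ℝ} (hk : 1 ≤ k) (hd : 0 ≤ d) (hn : n = 2 * k ^ 2)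
    (hm : m = n - 1) (ht : t = n + 2 * k + d) (hy : y = 3 / 2 * k) :
    0 < (t * (t - 1) - y * t - m * (t - 1)) *
      (1 + y + y ^ 2 / 2 + y ^ 3 / 6 + y ^ 4 / 24 + y ^ 5 / 120) -
      (t * m * y + (t - m) * (t - 1 - y)) := by
  obtain ⟨z, hz, rfl⟩ : ∃ z, 0 ≤ z ∧ k = 1 + z := ⟨k - 1, by linarith, by ring⟩
  subst hy ht hm hn
  ring_nf
  positivity

/-- Parametrization of the range `n + √(2 n) ≤ t` by `k = √(n / 2)`. -/
theorem exists_sqrt_param {m : ℕ} (hm : 1 ≤ m) {t : ℝ}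
    (ht : ((m + 1 : ℕ) : ℝ) + √(2 * ((m + 1 : ℕ) : ℝ)) ≤ t) :
    ∃ k d : ℝ, k = √(((m + 1 : ℕ) : ℝ) / 2) ∧ 1 ≤ k ∧ 0 ≤ d ∧ (m : ℝ) = 2 * k ^ 2 - 1 ∧
      t = 2 * k ^ 2 + 2 * k + d := by
  have hm' : (1 : ℝ) ≤ m := by exact_mod_cast hm
  rw [Nat.cast_add, Nat.cast_one] at ht ⊢
  set k := √(((m : ℝ) + 1) / 2) with hk
  have hk2 : k ^ 2 = ((m : ℝ) + 1) / 2 := Real.sq_sqrt (by positivity)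
  have hs : √(2 * ((m : ℝ) + 1)) = 2 * k := by
    rw [Real.sqrt_eq_iff_mul_self_eq (by positivity) (by positivity)]
    nlinarith
  rw [hs] at ht
  refine ⟨k, t - (2 * k ^ 2 + 2 * k), rfl, ?_, ?_, ?_, by ring⟩
  · rw [hk, Real.one_le_sqrt]; linarith
  · rw [hk2]; linarith
  · rw [hk2]; ring

/-- The light atoms alone suffice at `1 / (t + 1)`; the heavy term is only needed to be nonnegative.
-/
theorem heavyMass_uniform_lt_heavyMass {m t : ℕ} (hm : 1 ≤ m)
    (ht : ((m + 1 : ℕ) : ℝ) + √(2 * ((m + 1 : ℕ) : ℝ)) ≤ t) :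
    heavyMass m t (1 / ((m : ℝ) + 1)) < heavyMass m t (1 / ((t : ℝ) + 1)) := by
  have hm' : (1 : ℝ) ≤ m := by exact_mod_cast hm
  have hm0 : (0 : ℝ) < m := by linarith
  obtain ⟨k, d, -, hk, hd, hmk, htk⟩ := exists_sqrt_param hm ht
  have hQ := cubic_excess_pos hk hd rfl hmk htk rfl rfl
  set T : ℝ := t + 1 with hT
  have hmt : (m : ℝ) < t := by rw [hmk, htk]; linarith
  have hT0 : 0 < T := by positivity
  -- Chosen so that `1 - 1 / T = m / (m + 1) * (1 + q)`.
  set q : ℝ := (t - m) / (m * T) with hq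
  have hq0 : 0 ≤ q := div_nonneg (by linarith) (by positivity)
  have hcub := cubic_le_one_add_pow hq0 t
  have hmain : T / m < (1 + q) ^ t := by
    refine lt_of_lt_of_le ?_ hcub
    rw [← sub_pos]
    have : 1 + t * q + t * (t - 1) / 2 * q ^ 2 + t * (t - 1) * (t - 2) / 6 * q ^ 3 - T / m =
        (3 * t * (t - 1) * T * (t - m) ^ 2 * m + t * (t - 1) * (t - 2) * (t - m) ^ 3 -
          6 * T ^ 2 * m ^ 2 * (T + (t - m))) / (6 * m ^ 3 * T ^ 3) := by
      rw [hq]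
      field_simp
      rw [hT]
      ring
    rw [this]
    exact div_pos hQ (by positivity)
  have hterm : (1 - 1 / T) ^ t = (m / (m + 1)) ^ t * (1 + q) ^ t := by
    rw [← mul_pow]
    congr 1
    rw [hq]
    field_simp
    rw [hT]
    ring
  have hlast : 0 ≤ atomTerm t (1 - m * (1 / T)) := by
    have : m * (1 / T) ≤ 1 := by rw [mul_one_div, div_le_one hT0]; linarith
    exact mul_nonneg (by linarith) (pow_nonneg (by rw [sub_sub_cancel]; positivity) _)
  rw [heavyMass_uniform, heavyMass]
  have hU : 0 < ((m : ℝ) / (m + 1)) ^ t := by positivity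
  have : ((m : ℝ) / (m + 1)) ^ t < m * atomTerm t (1 / T) := by
    rw [atomTerm, hterm]
    calc ((m : ℝ) / (m + 1)) ^ t = (m / (m + 1)) ^ t * (m / T * (T / m)) := by
          field_simp
      _ < (m / (m + 1)) ^ t * (m / T * (1 + q) ^ t) := by gcongr
      _ = _ := by ring
  linarith

/-! ### Bounds for the light mass -/

theorem exists_massSlope_neg {m j : ℕ} (hm : 1 ≤ m)
    (ht : ((m + 1 : ℕ) : ℝ) + √(2 * ((m + 1 : ℕ) : ℝ)) ≤ ((j + 3 : ℕ) : ℝ)) :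
    ∃ r : ℝ, 0 < r ∧ r < 1 ∧ massSlope m (j + 2) r < 0 ∧
      r ^ (j + 2) ≤ Real.exp (-√(((m + 1 : ℕ) : ℝ) / 2)) := by
  obtain ⟨k, d, hkdef, hk, hd, hmk, htk⟩ := exists_sqrt_param hm ht
  rw [← hkdef]
  -- The final exponential bound needs only `k ≤ y`; the factor `3 / 2` is the one for which
  -- `exp_margin_pos` is proved.
  obtain ⟨y, hy⟩ : ∃ y, y = 3 / 2 * k := ⟨_, rfl⟩
  have hR := exp_margin_pos hk hd rfl hmk htk hy
  set K : ℝ := ((j + 2 : ℕ) : ℝ) with hK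
  have htK : ((j + 3 : ℕ) : ℝ) = K + 1 := by rw [hK]; push_cast; ring
  rw [htK] at htk hR
  have hK0 : 0 < K := by positivity
  have hyK : y < K := by nlinarith
  have hy0 : 0 < y := by linarith
  have hexp : 1 + y + y ^ 2 / 2 + y ^ 3 / 6 + y ^ 4 / 24 + y ^ 5 / 120 ≤ Real.exp y := by
    have := Real.sum_le_exp_of_nonneg hy0.le 6
    simp [Finset.sum_range_succ, Nat.factorial] at this
    linarith
  have hpow : (1 - y / K) ^ (j + 2) ≤ Real.exp (-y) := Real.one_sub_div_pow_le_exp_neg hyK.le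
  have hr0 : 0 < 1 - y / K := by rw [sub_pos, div_lt_one hK0]; exact hyK
  refine ⟨1 - y / K, hr0, by linarith [div_pos hy0 hK0], ?_,
    hpow.trans (Real.exp_le_exp.2 (by linarith))⟩
  set r := 1 - y / K with hr
  have hrK : r * K = K - y := by rw [hr]; field_simp
  have hmK : (m : ℝ) < K + 1 := by rw [hmk, htk]; linarith
  have hm0 : (0 : ℝ) < m := by exact_mod_cast hm
  have hr1 : r < 1 := by linarith [div_pos hy0 hK0]
  set A := (K + 1) * r - m with hA
  set B := (K + 1) * m * (1 - r) + (K + 1 - m) * r with hB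
  have hB0 : 0 < B := by
    have : 0 < 1 - r := by linarith
    have : 0 < K + 1 - m := by linarith
    positivity
  have hAB : 0 < K * (A * (1 + y + y ^ 2 / 2 + y ^ 3 / 6 + y ^ 4 / 24 + y ^ 5 / 120) - B) := by
    convert hR using 1
    rw [hA, hB]
    linear_combination ((K + 1) * (1 + y + y ^ 2 / 2 + y ^ 3 / 6 + y ^ 4 / 24 + y ^ 5 / 120) +
      (K + 1) * m - (K + 1 - m)) * hrK
  have hAB := pos_of_mul_pos_right hAB hK0.le
  have hE : 0 < 1 + y + y ^ 2 / 2 + y ^ 3 / 6 + y ^ 4 / 24 + y ^ 5 / 120 := by positivity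
  have hA0 : 0 < A := by
    by_contra hneg
    nlinarith
  have hBA : B < A * Real.exp y := by nlinarith
  have hslope : massSlope m (j + 2) r = r ^ (j + 2) * B - A := by
    have : (((j + 2 : ℕ) : ℝ)) = K := rfl
    rw [massSlope_eq, this, hA, hB]
    ring
  have h1 : r ^ (j + 2) * B ≤ Real.exp (-y) * B := mul_le_mul_of_nonneg_right hpow hB0.le
  have h2 : Real.exp (-y) * B < Real.exp (-y) * (A * Real.exp y) :=
    mul_lt_mul_of_pos_left hBA (Real.exp_pos _)
  have h3 : Real.exp (-y) * (A * Real.exp y) = A := by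
    rw [mul_left_comm, ← Real.exp_add, neg_add_cancel, Real.exp_zero, mul_one]
  rw [hslope]
  linarith

/-- A point where `massSlope` is negative lies to the right of a non-uniform maximizer. -/
theorem IsMaxOn.ratio_le_of_massSlope_neg {m k : ℕ} (hm : 1 ≤ m) {x r : ℝ}
    (hx : x ∈ Set.Icc 0 (1 / ((m : ℝ) + 1))) (hne : x ≠ 1 / ((m : ℝ) + 1))
    (hmax : IsMaxOn (heavyMass m (k + 3)) (Set.Icc 0 (1 / ((m : ℝ) + 1))) x)
    (hr0 : 0 < r) (hr : massSlope m (k + 2) r < 0) : m * x / (1 - x) ≤ r := by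
  by_contra! hlt
  have hm0 : (0 : ℝ) < m := by exact_mod_cast hm
  have hcont := (continuous_massSlope m (k + 2))
  have hx1 := lt_one_of_mem_Icc hm hx
  -- The slope is `m > 0` at `0`, so one zero lies left of `r`. The ratio of `x` is another, leaving
  -- no room for a zero between.
  obtain ⟨r₀, hr₀, e₀⟩ : ∃ r₀ ∈ Set.Ioo 0 r, massSlope m (k + 2) r₀ = 0 :=
    intermediate_value_Ioo' hr0.le hcont.continuousOn ⟨hr, by simp [massSlope, hm0]⟩
  have hx₁ := massSlope_ratio_eq_zero hx1 (IsMaxOn.deriv_heavyMass_eq_zero hm hx hne hmax)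
  have hlt1 := ratio_lt_one hx1 (lt_of_le_of_ne hx.2 hne)
  set y : ℝ := r / (m + r) with hy
  have hy0 : 0 < y := by positivity
  have hyr : m * y / (1 - y) = r := by
    have : 1 - y = m / (m + r) := by rw [hy]; field_simp; ring
    rw [this, hy]; field_simp
  have hyx : y < x := by
    rw [lt_div_iff₀ (by linarith)] at hlt
    rw [hy, div_lt_iff₀ (by positivity)]
    linarith
  have hneg : ∀ s, r < s → s < m * x / (1 - x) → massSlope m (k + 2) s < 0 := by
    intro s hrs hsx
    by_contra! hs
    obtain ⟨c, hc, ec⟩ : ∃ c ∈ Set.Icc r s, massSlope m (k + 2) c = 0 :=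
      intermediate_value_Icc hrs.le hcont.continuousOn ⟨hr.le, hs⟩
    have hcr : r ≠ c := by rintro rfl; linarith
    exact massSlope_no_three_zeros hm hr₀.1 (hr₀.2.trans_le hc.1) (hc.2.trans_lt hsx) hlt1 e₀ ec hx₁
  have hanti : StrictAntiOn (heavyMass m (k + 3)) (Set.Icc y x) := by
    refine strictAntiOn_of_deriv_neg (convex_Icc _ _)
      (fun z _ => (hasDerivAt_heavyMass m (k + 2) z).continuousAt.continuousWithinAt) ?_
    intro z hz
    rw [interior_Icc] at hz
    have hz1 := hz.2.trans hx1
    rw [(hasDerivAt_heavyMass m (k + 2) z).deriv, deriv_heavyMass_eq m (k + 2) hz1]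
    refine mul_neg_of_pos_of_neg (pow_pos (by linarith) _) (hneg _ ?_ (ratio_lt_ratio hm hz.2 hx1))
    rw [← hyr]
    exact ratio_lt_ratio hm hz.1 hz1
  have h1 := hanti ⟨le_rfl, hyx.le⟩ ⟨hyx.le, le_rfl⟩ hyx
  have h2 : heavyMass m (k + 3) y ≤ _ := hmax ⟨hy0.le, hyx.le.trans hx.2⟩
  linarith

/-- Solving the critical equation for `x - 1 / T` gives a positive power of the ratio times a number
in `(0, 1)`. -/
theorem IsMaxOn.heavyMass_bounds {m t : ℕ} (hm : 1 ≤ m)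
    (ht : ((m + 1 : ℕ) : ℝ) + √(2 * ((m + 1 : ℕ) : ℝ)) ≤ t) {x : ℝ}
    (hx : x ∈ Set.Icc 0 (1 / ((m : ℝ) + 1))) (hne : x ≠ 1 / ((m : ℝ) + 1))
    (hmax : IsMaxOn (heavyMass m t) (Set.Icc 0 (1 / ((m : ℝ) + 1))) x) :
    1 / ((t : ℝ) + 1) < x ∧
      x < 1 / ((t : ℝ) + 1) + Real.exp (-√(((m + 1 : ℕ) : ℝ) / 2)) := by
  have hm0 : (0 : ℝ) < m := by exact_mod_cast hm
  have hmt : m + 1 < t := by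
    have h1 : (0 : ℝ) < √(2 * ((m + 1 : ℕ) : ℝ)) := by positivity
    have h2 : ((m + 1 : ℕ) : ℝ) < t := by linarith
    exact_mod_cast h2
  obtain ⟨j, rfl⟩ : ∃ j, t = j + 3 := Nat.exists_eq_add_of_le' (by omega)
  obtain ⟨r, hr0, -, hr, hrexp⟩ := exists_massSlope_neg hm ht
  have hle := IsMaxOn.ratio_le_of_massSlope_neg hm hx hne hmax hr0 hr
  have hx1 := lt_one_of_mem_Icc hm hx
  have hx0 := IsMaxOn.heavyMass_pos hm (by omega) hx hmax
  have hder := IsMaxOn.deriv_heavyMass_eq_zero hm hx hne hmax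
  have hder := (mul_eq_zero.1 hder).resolve_left hm0.ne'
  have h1x : 0 < 1 - x := by linarith
  have hρ0 : 0 < m * x / (1 - x) := by positivity
  set T : ℝ := ((j + 3 : ℕ) : ℝ) + 1 with hT
  have hT0 : 0 < T := by positivity
  have hjT : ((j + 2 : ℕ) : ℝ) + 2 = T := by rw [hT]; push_cast; ring
  have hmT : (m : ℝ) + 1 < T := by rw [hT]; exact_mod_cast (by omega)
  have hnx := mul_le_of_mem_Icc hx
  have hy : 1 / T < 1 - m * x := by
    have h1 : 1 / T < 1 / ((m : ℝ) + 1) := one_div_lt_one_div_of_lt (by positivity) hmT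
    have h2 : 1 / ((m : ℝ) + 1) ≤ 1 - m * x := by
      rw [div_le_iff₀ (by positivity)]
      nlinarith
    linarith
  have hpos : 0 < (m * x / (1 - x)) ^ (j + 2) := by positivity
  have hkey : x - 1 / T = (m * x / (1 - x)) ^ (j + 2) * (1 - m * x - 1 / T) := by
    unfold atomTermDeriv at hder
    rw [hjT, sub_sub_cancel] at hder
    rw [div_pow]
    field_simp
    linear_combination (-1 : ℝ) * hder
  have hup : (m * x / (1 - x)) ^ (j + 2) * (1 - m * x - 1 / T) <
      (m * x / (1 - x)) ^ (j + 2) * 1 := by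
    refine mul_lt_mul_of_pos_left ?_ hpos
    have : 0 < 1 / T := by positivity
    nlinarith
  have hpow : (m * x / (1 - x)) ^ (j + 2) ≤ r ^ (j + 2) := pow_le_pow_left₀ hρ0.le hle _
  constructor
  · have := mul_pos hpos (sub_pos.2 hy)
    linarith
  · linarith

/-! ### Uniform optimality near `n + a √(2n)`, `a < 1` -/

theorem one_sub_le_exp_neg_sub_sq {u : ℝ} (hu : 0 ≤ u) (hu1 : u ≤ 1) :
    1 - u ≤ Real.exp (-u - u ^ 2 / 2) := by
  rcases hu1.lt_or_eq with h | rfl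
  · rw [← Real.log_le_iff_le_exp (by linarith)]
    have hs := Real.hasSum_pow_div_log_of_abs_lt_one (x := u) (by rwa [abs_of_nonneg hu])
    have := sum_le_hasSum (Finset.range 2) (fun i _ => by positivity) hs
    norm_num [Finset.sum_range_succ] at this
    linarith
  · simpa using (Real.exp_pos _).le

/-- Since `s (1 - s ^ k) ≤ (1 - s) k`, the cofactor of `1 - s` is at least `m + (k + 1 - m)`. -/
theorem massSlope_nonneg_of_le_pow {m k : ℕ} (hmk : m ≤ k + 1) {s : ℝ} (hs : 0 ≤ s) (hs1 : s ≤ 1)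
    (h : (k : ℝ) + 1 - m ≤ m * s ^ k) : 0 ≤ massSlope m k s := by
  have hmk' : (m : ℝ) ≤ k + 1 := by exact_mod_cast hmk
  have hgeom : s * (1 - s ^ k) ≤ (1 - s) * k := by
    rw [← mul_neg_geom_sum s k, mul_left_comm]
    refine mul_le_mul_of_nonneg_left ?_ (by linarith)
    have : ∑ i ∈ Finset.range k, s ^ i ≤ k := by
      calc _ ≤ ∑ i ∈ Finset.range k, (1 : ℝ) :=
            Finset.sum_le_sum fun i _ => pow_le_one₀ hs hs1
        _ = k := by simp
    exact (mul_le_of_le_one_left (Finset.sum_nonneg fun i _ => pow_nonneg hs i) hs1).trans this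
  have h1 := mul_le_mul_of_nonneg_left hgeom (sub_nonneg.2 hmk')
  have h2 := mul_le_mul_of_nonneg_left h (by positivity : (0 : ℝ) ≤ k + 1)
  have h3 : 0 ≤ (1 - s) * (m + (k + 1) * (m * s ^ k) - (k + 1 - m) * k) :=
    mul_nonneg (by linarith) (by nlinarith)
  rw [massSlope_eq]
  linarith

/-- If `r ^ k ≥ η`, the function increases from `x` to the uniform point. Otherwise the light part
is controlled by `u η - u² / 2 ≤ η² / 2`, and the heavy part by the smallness of `r ^ k`. -/
theorem isMaxOn_heavyMass_uniform_of_exp_le {m k : ℕ} (hm : 1 ≤ m) (hmk : m ≤ k + 1)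
    (hkm : k + 1 ≤ 2 * m) {η : ℝ} (hη : η = ((k : ℝ) + 1 - m) / m)
    (h : m * Real.exp (η ^ 2 / 2) + 2 * (Real.exp 1 * √η) ≤ m + 1) :
    IsMaxOn (heavyMass m (k + 1)) (Set.Icc 0 (1 / ((m : ℝ) + 1))) (1 / ((m : ℝ) + 1)) := by
  intro x hx
  rw [Set.mem_ofPred_eq]
  have hm0 : (0 : ℝ) < m := by exact_mod_cast hm
  have hmk' : (m : ℝ) ≤ k + 1 := by exact_mod_cast hmk
  have hkm' : (k : ℝ) + 1 ≤ 2 * m := by exact_mod_cast hkm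
  have hx1 := lt_one_of_mem_Icc hm hx
  have h1x : 0 < 1 - x := by linarith
  have hnx := mul_le_of_mem_Icc hx
  have hη0 : 0 ≤ η := by rw [hη]; exact div_nonneg (by linarith) hm0.le
  have hmη : m * η = k + 1 - m := by rw [hη]; field_simp
  set r := m * x / (1 - x) with hr
  have hr0 : 0 ≤ r := div_nonneg (mul_nonneg hm0.le hx.1) h1x.le
  have hr1 : r ≤ 1 := by rw [hr, div_le_one h1x]; linarith
  by_cases hcase : η ≤ r ^ k
  · refine heavyMass_le_uniform_of_massSlope_nonneg hm hx fun s hs hs1 =>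
      massSlope_nonneg_of_le_pow hmk (hr0.trans hs.le) hs1.le ?_
    rw [← hmη]
    exact mul_le_mul_of_nonneg_left (hcase.trans (pow_le_pow_left₀ hr0 hs.le k)) hm0.le
  push Not at hcase
  obtain ⟨u, hu⟩ : ∃ u, u = 1 - (m + 1) * x := ⟨_, rfl⟩
  have hu0 : 0 ≤ u := by linarith
  have hu1 : u ≤ 1 := by
    have : 0 ≤ ((m : ℝ) + 1) * x := mul_nonneg (by linarith) hx.1
    linarith
  have ha : (1 - x) * (m + 1) / m = 1 + u / m := by rw [hu]; field_simp; ring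
  have hb : ((m : ℝ) + 1) * x = 1 - u := by linarith
  have hb0 : 0 ≤ 1 - u := by linarith
  have hra : 1 - u = r * (1 + u / m) := by rw [← ha, ← hb, hr]; field_simp
  have hapow : (1 + u / m) ^ (k + 1) ≤ Real.exp (u * (1 + η)) := by
    have : u * (1 + η) = ((k + 1 : ℕ) : ℝ) * (u / m) := by
      rw [hη]; push_cast; field_simp; ring
    rw [this, Real.exp_nat_mul]
    refine pow_le_pow_left₀ (by positivity) ?_ _
    linarith [Real.add_one_le_exp (u / m)]
  have hF1 : (1 - u) * (1 + u / m) ^ (k + 1) ≤ Real.exp (η ^ 2 / 2) := by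
    calc _ ≤ Real.exp (-u - u ^ 2 / 2) * Real.exp (u * (1 + η)) :=
          mul_le_mul (one_sub_le_exp_neg_sub_sq hu0 hu1) hapow (by positivity) (Real.exp_pos _).le
      _ ≤ Real.exp (η ^ 2 / 2) := by
          rw [← Real.exp_add, Real.exp_le_exp]
          nlinarith [sq_nonneg (u - η)]
  have hbpow : (1 - u) ^ (k + 1) ≤ Real.exp 1 ^ 2 * η := by
    rw [hra, mul_pow]
    have h1 : r ^ (k + 1) ≤ η := (pow_le_pow_of_le_one hr0 hr1 (Nat.le_succ k)).trans hcase.le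
    have h2 : (1 + u / m) ^ (k + 1) ≤ Real.exp 1 ^ 2 := by
      refine hapow.trans ?_
      rw [← Real.exp_nat_mul, Real.exp_le_exp]
      have : η ≤ 1 := by rw [hη, div_le_one hm0]; linarith
      push_cast
      nlinarith
    rw [mul_comm]
    exact mul_le_mul h2 h1 (by positivity) (by positivity)
  -- Split the power in two: one half absorbs `1 + m u`, the other supplies `√η`.
  set w := √((1 - u) ^ (k + 1)) with hw
  have hw2 : w ^ 2 = (1 - u) ^ (k + 1) := Real.sq_sqrt (by positivity)
  have hwη : w ≤ Real.exp 1 * √η := by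
    rw [hw, Real.sqrt_le_left (by positivity), mul_pow, Real.sq_sqrt hη0]
    exact hbpow
  have hwexp : (1 + m * u) * w ≤ 2 := by
    have h1 : w ≤ Real.exp (-(m * u / 2)) := by
      rw [hw, Real.sqrt_le_left (Real.exp_pos _).le, ← Real.exp_nat_mul]
      calc (1 - u) ^ (k + 1) ≤ Real.exp (-u) ^ (k + 1) :=
            pow_le_pow_left₀ hb0 (by linarith [Real.add_one_le_exp (-u)]) _
        _ ≤ _ := by
          rw [← Real.exp_nat_mul, Real.exp_le_exp]
          push_cast
          nlinarith
    have h2 : 1 + m * u ≤ 2 * Real.exp (m * u / 2) := by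
      linarith [Real.add_one_le_exp (m * u / 2)]
    calc (1 + m * u) * w ≤ 2 * Real.exp (m * u / 2) * Real.exp (-(m * u / 2)) :=
          mul_le_mul h2 h1 (Real.sqrt_nonneg _) (by positivity)
      _ = 2 := by rw [mul_assoc, ← Real.exp_add, add_neg_cancel, Real.exp_zero, mul_one]
  have hF2 : (1 + m * u) * (1 - u) ^ (k + 1) ≤ 2 * (Real.exp 1 * √η) := by
    rw [← hw2, sq, ← mul_assoc]
    exact mul_le_mul hwexp hwη (Real.sqrt_nonneg _) (by norm_num)
  have hpos : 0 ≤ heavyMass m (k + 1) (1 / ((m : ℝ) + 1)) := by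
    rw [heavyMass_uniform]; positivity
  rw [heavyMass_eq_uniform_mul hm, ha, hb]
  refine mul_le_of_le_one_right hpos ?_
  have hx' : x = (1 - u) / (m + 1) := by rw [← hb]; field_simp
  have : m * x * (1 + u / m) ^ (k + 1) + (1 - m * x) * (1 - u) ^ (k + 1) =
      (m * ((1 - u) * (1 + u / m) ^ (k + 1)) + (1 + m * u) * (1 - u) ^ (k + 1)) / (m + 1) := by
    rw [hx']; field_simp; ring
  rw [this, div_le_one (by positivity)]
  have := mul_le_mul_of_nonneg_left hF1 hm0.le
  linarith

theorem tendsto_excess_div_sqrt (a : ℝ) :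
    Filter.Tendsto (fun m : ℕ => (1 + a * √(2 * ((m : ℝ) + 1))) / √m) Filter.atTop
      (nhds (a * √2)) := by
  have hinv : Filter.Tendsto (fun m : ℕ => (√(m : ℝ))⁻¹) Filter.atTop (nhds 0) :=
    (Real.tendsto_sqrt_atTop.comp tendsto_natCast_atTop_atTop).inv_tendsto_atTop
  have h1 : Filter.Tendsto (fun m : ℕ => 1 + (m : ℝ)⁻¹) Filter.atTop (nhds (1 + 0)) :=
    tendsto_const_nhds.add (tendsto_inv_atTop_zero.comp tendsto_natCast_atTop_atTop)
  have h2 := hinv.add ((h1.const_mul 2).sqrt.const_mul a)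
  rw [zero_add, add_zero, mul_one] at h2
  refine h2.congr' ?_
  filter_upwards [Filter.eventually_ge_atTop 1] with m hm
  have hm0 : (0 : ℝ) < m := by exact_mod_cast hm
  rw [show 2 * (1 + (m : ℝ)⁻¹) = 2 * (m + 1) / m by field_simp, Real.sqrt_div' _ hm0.le]
  ring

theorem eventually_isMaxOn_heavyMass_uniform {a : ℝ} (ha : 0 < a) (ha1 : a < 1) :
    ∀ᶠ m : ℕ in Filter.atTop,
      IsMaxOn (heavyMass m ⌊((m : ℝ) + 1) + a * √(2 * ((m : ℝ) + 1))⌋₊)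
        (Set.Icc 0 (1 / ((m : ℝ) + 1))) (1 / ((m : ℝ) + 1)) := by
  set E : ℕ → ℝ := fun m => (1 + a * √(2 * ((m : ℝ) + 1))) / √m with hE
  have hElim : Filter.Tendsto E Filter.atTop (nhds (a * √2)) := tendsto_excess_div_sqrt a
  have hinv : Filter.Tendsto (fun m : ℕ => (√(m : ℝ))⁻¹) Filter.atTop (nhds 0) :=
    (Real.tendsto_sqrt_atTop.comp tendsto_natCast_atTop_atTop).inv_tendsto_atTop
  have hζ : Filter.Tendsto (fun m => E m * (√(m : ℝ))⁻¹) Filter.atTop (nhds 0) := by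
    simpa using hElim.mul hinv
  -- The criterion's left side minus `m` is at most this, by `exp z ≤ 1 + z + z²` at `z = η² / 2`.
  have hψ : Filter.Tendsto (fun m => E m ^ 2 / 2 * (1 + (E m * (√(m : ℝ))⁻¹) ^ 2 / 2) +
      2 * (Real.exp 1 * √(E m * (√(m : ℝ))⁻¹))) Filter.atTop (nhds (a ^ 2)) := by
    have h := (((hElim.pow 2).div_const 2).mul (((hζ.pow 2).div_const 2).const_add 1)).add
      ((hζ.sqrt.const_mul (Real.exp 1)).const_mul 2)
    convert h using 2
    rw [mul_pow, Real.sq_sqrt (by norm_num)]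
    simp
  filter_upwards [hψ.eventually_lt_const (show a ^ 2 < 1 by nlinarith),
    hζ.eventually_lt_const one_pos, Filter.eventually_ge_atTop 1] with m hψm hζm hm
  have hm0 : (0 : ℝ) < m := by exact_mod_cast hm
  set D : ℝ := 1 + a * √(2 * ((m : ℝ) + 1)) with hD
  have hD0 : 0 ≤ D := by positivity
  have hED : E m * (√(m : ℝ))⁻¹ = D / m := by
    rw [hE]
    simp only
    rw [← hD, ← div_eq_mul_inv, div_div, Real.mul_self_sqrt hm0.le]
  have hE2 : E m ^ 2 = D ^ 2 / m := by
    rw [hE]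
    simp only
    rw [← hD, div_pow, Real.sq_sqrt hm0.le]
  rw [hED] at hζm hψm
  rw [hE2] at hψm
  rw [div_lt_one hm0] at hζm
  have hfl : ((m : ℝ) + 1) + a * √(2 * ((m : ℝ) + 1)) = m + D := by rw [hD]; ring
  rw [hfl]
  obtain ⟨t, ht⟩ : ∃ t, t = ⌊(m : ℝ) + D⌋₊ := ⟨_, rfl⟩
  rw [← ht]
  have hmt : m + 1 ≤ t := by
    rw [ht]
    refine Nat.le_floor ?_
    push_cast
    have : 0 ≤ a * √(2 * ((m : ℝ) + 1)) := by positivity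
    linarith
  have htD : (t : ℝ) ≤ m + D := by rw [ht]; exact Nat.floor_le (by positivity)
  obtain ⟨k, rfl⟩ : ∃ k, t = k + 1 := Nat.exists_eq_add_of_le' (by omega)
  have hmk : (m : ℝ) + 1 ≤ k + 1 := by exact_mod_cast hmt
  push_cast at htD
  refine isMaxOn_heavyMass_uniform_of_exp_le hm (by omega) ?_ rfl ?_
  · have : (k : ℝ) + 1 ≤ 2 * m := by linarith
    exact_mod_cast this
  set η : ℝ := ((k : ℝ) + 1 - m) / m with hη
  have hη0 : 0 ≤ η := div_nonneg (by linarith) hm0.le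
  have hηD : η ≤ D / m := div_le_div_of_nonneg_right (by linarith) hm0.le
  have hD1 : D / m < 1 := (div_lt_one hm0).2 hζm
  have hη2 : η ^ 2 ≤ (D / m) ^ 2 := pow_le_pow_left₀ hη0 hηD 2
  have hη1 : η ^ 2 / 2 ≤ 1 := by nlinarith
  have hexp : Real.exp (η ^ 2 / 2) ≤ 1 + η ^ 2 / 2 * (1 + η ^ 2 / 2) := by
    have := abs_le.1 (Real.abs_exp_sub_one_sub_id_le (x := η ^ 2 / 2)
      (by rwa [abs_of_nonneg (by positivity)]))
    linarith [this.2]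
  have hquad : m * (η ^ 2 / 2 * (1 + η ^ 2 / 2)) ≤ D ^ 2 / m / 2 * (1 + (D / m) ^ 2 / 2) := by
    have : D ^ 2 / m / 2 * (1 + (D / m) ^ 2 / 2) =
        m * ((D / m) ^ 2 / 2 * (1 + (D / m) ^ 2 / 2)) := by field_simp
    rw [this]
    gcongr
  have hsqrt : 2 * (Real.exp 1 * √η) ≤ 2 * (Real.exp 1 * √(D / m)) := by gcongr
  have := mul_le_mul_of_nonneg_left hexp hm0.le
  linarith

/-! ### The threshold and its asymptotics -/

theorem exists_threshold {m : ℕ} (hm : 1 ≤ m) :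
    ∃ v, m + 1 < v ∧ ∀ t, 1 ≤ t →
      (IsMaxOn (heavyMass m t) (Set.Icc 0 (1 / ((m : ℝ) + 1))) (1 / ((m : ℝ) + 1)) ↔ t ≤ v) := by
  classical
  set U : ℕ → Prop := fun t =>
    IsMaxOn (heavyMass m t) (Set.Icc 0 (1 / ((m : ℝ) + 1))) (1 / ((m : ℝ) + 1)) with hU
  have hdown : ∀ t s, 1 ≤ t → t ≤ s → U s → U t := by
    intro t s ht hts hs x hx
    rcases hts.eq_or_lt with rfl | hts
    · exact hs hx
    by_contra hlt
    rw [Set.mem_ofPred_eq, not_le] at hlt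
    have hne : x ≠ 1 / ((m : ℝ) + 1) := by rintro rfl; exact lt_irrefl _ hlt
    exact (heavyMass_uniform_lt_of_lt hm ht hts hx hne hlt.le).not_ge (hs hx)
  have hex : ∃ t, 1 ≤ t ∧ ¬ U t := by
    set y : ℝ := ((m + 1 : ℕ) : ℝ) + √(2 * ((m + 1 : ℕ) : ℝ)) with hy
    have hmy : (m : ℝ) + 1 ≤ y := by
      have := Real.sqrt_nonneg (2 * ((m + 1 : ℕ) : ℝ))
      rw [hy]; push_cast at this ⊢; linarith
    have hceil := Nat.le_ceil y
    refine ⟨⌈y⌉₊, Nat.one_le_ceil_iff.2 (by have : (0 : ℝ) ≤ m := m.cast_nonneg; linarith),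
      fun h => ?_⟩
    have hlt := heavyMass_uniform_lt_heavyMass hm (hy ▸ hceil)
    refine hlt.not_ge (h ⟨by positivity, ?_⟩)
    exact one_div_le_one_div_of_le (by positivity) (by linarith)
  obtain ⟨h1, hnot⟩ := Nat.find_spec hex
  have hmin : ∀ t, 1 ≤ t → t < Nat.find hex → U t := fun t ht hlt => by
    have := Nat.find_min hex hlt
    tauto
  have hgt : m + 2 < Nat.find hex := by
    by_contra! hle
    exact hnot (hdown _ _ h1 hle (isMaxOn_heavyMass_uniform hm))
  -- The last sample size at which uniform is optimal; a non-uniform tie is still possible there.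
  refine ⟨Nat.find hex - 1, by omega, fun t ht => ⟨fun h => ?_, fun h => hmin t ht (by omega)⟩⟩
  by_contra! hlt
  exact hnot (hdown _ t h1 (by omega) h)

theorem isGlobalMaximizer_fin_one {t : ℕ} {p : Fin 1 → ℝ} :
    IsGlobalMaximizer t p ↔ p = fun _ => 1 := by
  have key : ∀ q : Fin 1 → ℝ, q ∈ stdSimplex ℝ (Fin 1) → q = fun _ => 1 := by
    intro q hq
    have := hq.2
    rw [Fin.sum_univ_one] at this
    exact funext fun i => by rw [Subsingleton.elim i 0, this]
  obtain ⟨q, hq⟩ := exists_isGlobalMaximizer (n := 1) le_rfl t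
  refine ⟨fun h => key p h.1, fun h => ?_⟩
  rwa [h, ← key q hq.1]

/-- A non-uniform tie at `t` would strictly beat uniform at `v`, which explains `t < v`. -/
theorem isGlobalMaximizer_iff_eq_uniform {m t v : ℕ} (hm : 1 ≤ m) (ht : 1 ≤ t) (htv : t < v)
    (hv : IsMaxOn (heavyMass m v) (Set.Icc 0 (1 / ((m : ℝ) + 1))) (1 / ((m : ℝ) + 1)))
    (ht' : IsMaxOn (heavyMass m t) (Set.Icc 0 (1 / ((m : ℝ) + 1))) (1 / ((m : ℝ) + 1)))
    {p : Fin (m + 1) → ℝ} :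
    IsGlobalMaximizer t p ↔ p = fun _ => 1 / ((m + 1 : ℕ) : ℝ) := by
  constructor
  · intro hp
    obtain ⟨h, x, hx, rfl, hmax⟩ := hp.exists_eq_heavyVector hm ht
    by_cases hne : x = 1 / ((m : ℝ) + 1)
    · rw [hne, heavyVector_uniform]
    · exact absurd (hv hx)
        (heavyMass_uniform_lt_of_lt hm ht htv hx hne (hmax (uniform_mem_Icc m))).not_ge
  · rintro rfl
    rw [← heavyVector_uniform m 0]
    exact isGlobalMaximizer_heavyVector hm ht 0 (uniform_mem_Icc m) ht'

theorem light_lt_heavy {m : ℕ} {x : ℝ} (hx : x ∈ Set.Icc 0 (1 / ((m : ℝ) + 1)))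
    (hne : x ≠ 1 / ((m : ℝ) + 1)) : x < 1 - m * x := by
  have := lt_of_le_of_ne hx.2 hne
  rw [lt_div_iff₀ (by positivity)] at this
  linarith

theorem isStrictlyHeavyAtom_heavyVector {m : ℕ} (h : Fin (m + 1)) {x : ℝ}
    (hx : x ∈ Set.Icc 0 (1 / ((m : ℝ) + 1))) (hne : x ≠ 1 / ((m : ℝ) + 1)) :
    IsStrictlyHeavyAtom (heavyVector m h x) h := by
  refine ⟨fun i j hi hj => by simp [heavyVector, hi, hj], fun i hi => ?_⟩
  simpa [heavyVector, hi] using light_lt_heavy hx hne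

theorem heavyVector_comp_swap {m : ℕ} (h h' : Fin (m + 1)) (x : ℝ) :
    heavyVector m h' x = heavyVector m h x ∘ Equiv.swap h h' := by
  funext i
  simp only [heavyVector, Function.comp, Equiv.swap_apply_eq_iff, Equiv.swap_apply_left]

theorem exists_strictlyHeavy_globalMaximizer {m t : ℕ} (hm : 1 ≤ m) (ht : 3 ≤ t)
    (hu : ¬ IsMaxOn (heavyMass m t) (Set.Icc 0 (1 / ((m : ℝ) + 1))) (1 / ((m : ℝ) + 1))) :
    ∃ p : Fin (m + 1) → ℝ, IsGlobalMaximizer t p ∧ (∃ h, IsStrictlyHeavyAtom p h) ∧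
      ∀ q : Fin (m + 1) → ℝ, IsGlobalMaximizer t q →
        ∃ σ : Equiv.Perm (Fin (m + 1)), q = p ∘ σ := by
  obtain ⟨p, hp⟩ := exists_isGlobalMaximizer (n := m + 1) (by omega) t
  obtain ⟨h, x, hx, hpx, hmax⟩ := hp.exists_eq_heavyVector hm (by omega)
  have hne : ∀ {y}, IsMaxOn (heavyMass m t) (Set.Icc 0 (1 / ((m : ℝ) + 1))) y →
      y ≠ 1 / ((m : ℝ) + 1) := by rintro y hy rfl; exact hu hy
  refine ⟨p, hp, ⟨h, hpx ▸ isStrictlyHeavyAtom_heavyVector h hx (hne hmax)⟩, fun q hq => ?_⟩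
  obtain ⟨h', y, hy, rfl, hmaxy⟩ := hq.exists_eq_heavyVector hm (by omega)
  obtain ⟨k, rfl⟩ := Nat.exists_eq_add_of_le' ht
  rw [hpx, IsMaxOn.heavyMass_unique hm hy hx (hne hmaxy) (hne hmax) hmaxy hmax]
  exact ⟨_, heavyVector_comp_swap h h' x⟩

theorem IsGlobalMaximizer.light_bounds {m t : ℕ} (hm : 1 ≤ m)
    (ht : ((m + 1 : ℕ) : ℝ) + √(2 * ((m + 1 : ℕ) : ℝ)) ≤ t) {p : Fin (m + 1) → ℝ}
    (hp : IsGlobalMaximizer t p) {h i : Fin (m + 1)} (hh : ∀ i, p i ≤ p h) (hi : i ≠ h) :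
    1 / ((t : ℝ) + 1) < p i ∧
      p i < 1 / ((t : ℝ) + 1) + Real.exp (-√(((m + 1 : ℕ) : ℝ) / 2)) := by
  have hmt : m + 1 ≤ t := by
    have h1 := Real.sqrt_nonneg (2 * ((m + 1 : ℕ) : ℝ))
    have h2 : ((m + 1 : ℕ) : ℝ) ≤ t := by linarith
    exact_mod_cast h2
  obtain ⟨h', x, hx, rfl, hmax⟩ := hp.exists_eq_heavyVector hm (by omega)
  have hne : x ≠ 1 / ((m : ℝ) + 1) := by
    rintro rfl
    have hmt' : (m : ℝ) + 1 ≤ t + 1 := by exact_mod_cast (by omega)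
    exact (heavyMass_uniform_lt_heavyMass hm ht).not_ge
      (hmax ⟨by positivity, one_div_le_one_div_of_le (by positivity) hmt'⟩)
  have hhh : h = h' := by
    by_contra hneq
    have := hh h'
    simp only [heavyVector, if_true, if_neg hneq] at this
    exact (light_lt_heavy hx hne).not_ge this
  subst hhh
  rw [heavyVector, if_neg hi]
  exact IsMaxOn.heavyMass_bounds hm ht hx hne hmax

theorem tendsto_threshold {v : ℕ → ℕ} (hv : ∀ m, 1 ≤ m → m + 1 < v m ∧ ∀ t, 1 ≤ t →
      (IsMaxOn (heavyMass m t) (Set.Icc 0 (1 / ((m : ℝ) + 1))) (1 / ((m : ℝ) + 1)) ↔ t ≤ v m)) :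
    Filter.Tendsto (fun m : ℕ => ((v m : ℝ) - ((m : ℝ) + 1)) / √(2 * ((m : ℝ) + 1)))
      Filter.atTop (nhds 1) := by
  refine tendsto_order.2 ⟨fun b hb => ?_, fun b hb => ?_⟩
  · obtain ⟨a, hab, ha1⟩ := exists_between (max_lt hb one_pos)
    have hba := (le_max_left _ _).trans_lt hab
    have ha0 := (le_max_right _ _).trans_lt hab
    have hsqrt : Filter.Tendsto (fun m : ℕ => √(2 * ((m : ℝ) + 1))) Filter.atTop Filter.atTop :=
      Real.tendsto_sqrt_atTop.comp (Filter.Tendsto.const_mul_atTop two_pos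
        (Filter.tendsto_atTop_add_const_right _ _ tendsto_natCast_atTop_atTop))
    filter_upwards [eventually_isMaxOn_heavyMass_uniform ha0 ha1,
      -- Makes the gap between `a` and `b` absorb the loss of at most `1` from the floor.
      hsqrt.eventually_ge_atTop (1 / (a - b)), Filter.eventually_ge_atTop 1] with m hmax hs hm
    have hs0 : 0 < √(2 * ((m : ℝ) + 1)) := by positivity
    set y : ℝ := ((m : ℝ) + 1) + a * √(2 * ((m : ℝ) + 1)) with hy
    have h1 : 1 ≤ ⌊y⌋₊ := Nat.le_floor (by
      have : (0 : ℝ) ≤ m := m.cast_nonneg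
      have : 0 ≤ a * √(2 * ((m : ℝ) + 1)) := by positivity
      push_cast; linarith)
    have hle : ((⌊y⌋₊ : ℕ) : ℝ) ≤ v m := by exact_mod_cast ((hv m hm).2 _ h1).1 hmax
    have hlt := Nat.lt_floor_add_one y
    rw [div_le_iff₀ (by linarith)] at hs
    rw [lt_div_iff₀ hs0]
    linarith
  · filter_upwards [Filter.eventually_ge_atTop 1] with m hm
    have hs0 : 0 < √(2 * ((m : ℝ) + 1)) := by positivity
    refine lt_trans ((div_lt_one hs0).2 ?_) hb
    by_contra! hle
    have hU := ((hv m hm).2 (v m) (by have := (hv m hm).1; omega)).2 le_rfl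
    have hge : ((m + 1 : ℕ) : ℝ) + √(2 * ((m + 1 : ℕ) : ℝ)) ≤ v m := by push_cast; linarith
    have hmv : (m : ℝ) + 1 ≤ v m + 1 := by exact_mod_cast (by have := (hv m hm).1; omega)
    exact (heavyMass_uniform_lt_heavyMass hm hge).not_ge
      (hU ⟨by positivity, one_div_le_one_div_of_le (by positivity) hmv⟩)

theorem mainTheorem4 :
    -- (i) local maximizers
    (∀ n t : ℕ, 1 ≤ t → ∀ p : Fin n → ℝ, IsLocalMaximizer t p → ∃ h, IsHeavyAtom p h) ∧
    (∃ τ : ℕ → ℕ,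
      -- (ii) the threshold
      (∀ n : ℕ, 1 ≤ n →
        n < τ n ∧
        (∀ t : ℕ, 1 ≤ t → t < τ n →
          ∀ p : Fin n → ℝ, IsGlobalMaximizer t p ↔ p = fun _ => 1 / (n : ℝ)) ∧
        (∀ t : ℕ, τ n < t →
          ∃ p : Fin n → ℝ, IsGlobalMaximizer t p ∧ (∃ h, IsStrictlyHeavyAtom p h) ∧
            ∀ q : Fin n → ℝ, IsGlobalMaximizer t q → ∃ σ : Equiv.Perm (Fin n), q = p ∘ σ)) ∧
      -- (iii) its asymptotics
      Filter.Tendsto (fun n : ℕ => ((τ n : ℝ) - n) / √(2 * (n : ℝ))) Filter.atTop (nhds 1)) ∧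
    -- (iv) the light mass of a global maximizer
    (∀ n t : ℕ, (n : ℝ) + √(2 * (n : ℝ)) ≤ t →
      ∀ p : Fin n → ℝ, IsGlobalMaximizer t p →
        ∀ h, (∀ i, p i ≤ p h) → ∀ i, i ≠ h →
          1 / ((t : ℝ) + 1) < p i ∧
            p i < 1 / ((t : ℝ) + 1) + Real.exp (-√((n : ℝ) / 2))) := by
  have hthr : ∀ m : ℕ, ∃ v, m + 1 < v ∧ (1 ≤ m → ∀ t, 1 ≤ t →
      (IsMaxOn (heavyMass m t) (Set.Icc 0 (1 / ((m : ℝ) + 1))) (1 / ((m : ℝ) + 1)) ↔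
        t ≤ v)) := by
    intro m
    rcases Nat.eq_zero_or_pos m with rfl | hm
    -- One-point space: any value above `1` serves, as only one distribution exists.
    · exact ⟨2, by omega, by omega⟩
    · obtain ⟨v, hv, h⟩ := exists_threshold hm
      exact ⟨v, hv, fun _ => h⟩
  choose v hv hthr using hthr
  refine ⟨fun n t ht p hp => hp.exists_isHeavyAtom ht, ⟨fun n => v (n - 1), ?_, ?_⟩, ?_⟩
  · intro n hn
    obtain ⟨m, rfl⟩ := Nat.exists_eq_add_of_le' hn
    simp only [Nat.add_sub_cancel]
    refine ⟨hv m, fun t ht htv p => ?_, fun t htv => ?_⟩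
    · rcases Nat.eq_zero_or_pos m with rfl | hm
      · simpa using isGlobalMaximizer_fin_one
      · exact isGlobalMaximizer_iff_eq_uniform hm ht htv
          ((hthr m hm _ (by omega)).2 le_rfl) ((hthr m hm t ht).2 htv.le)
    · have := hv m
      rcases Nat.eq_zero_or_pos m with rfl | hm
      · refine ⟨fun _ => 1, isGlobalMaximizer_fin_one.2 rfl, ⟨0, fun i j hi => ?_, fun i hi => ?_⟩,
          fun q hq => ⟨1, isGlobalMaximizer_fin_one.1 hq⟩⟩
        · exact absurd (Subsingleton.elim (α := Fin 1) i 0) hi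
        · exact absurd (Subsingleton.elim (α := Fin 1) i 0) hi
      · refine exists_strictlyHeavy_globalMaximizer hm (by omega) fun h => ?_
        have := (hthr m hm t (by omega)).1 h
        omega
  · rw [← Filter.tendsto_add_atTop_iff_nat 1]
    simpa using tendsto_threshold fun m hm => ⟨hv m, hthr m hm⟩
  · intro n t ht p hp h hh i hi
    rcases n with _ | _ | m
    · exact i.elim0
    · exact absurd (Subsingleton.elim (α := Fin 1) i h) hi
    · exact hp.light_bounds (by omega) ht hh hi
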